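/- Let $m\ge 2$ and let $T_m$ be the $m$-adic rooted tree, whose vertices are the finite words over an alphabet of $m$ letters, the $n$th level being the set of words of length $n$. Let $\mathrm{Aut}\,T_m$ be the group of graph automorphisms of $T_m$ fixing the root, let $\mathrm{St}(n)$ be the subgroup fixing every vertex of the $n$th level, and give $\mathrm{Aut}\,T_m$ the congruence topology, in which the subgroups $\mathrm{St}(n)$ form a basis of neighbourhoods of the identity. The section of $g\in\mathrm{Aut}\,T_m$ at a vertex $v$ is the automorphism $g|_v$ with $g(vu)=g(v)\,g|_v(u)$ for every word $u$. A subgroup $G\le\mathrm{Aut}\,T_m$ is *regular branch* if it is self-similar (all sections of elements of $G$ lie in $G$), acts transitively on every level, and has a finite-index subgroup $K$ such that for all $k_1,\dots,k_m\in K$ there is $g\in K\cap\mathrm{St}(1)$ whose sections at the $m$ vertices of the first level are $k_1,\dots,k_m$. A *filtration* of a profinite group $\Gamma$ is a descending chain $\mathcal N=\{\Gamma_i\}_{i\ge0}$ of open normal subgroups with $\Gamma_0=\Gamma$ and $\bigcap_i\Gamma_i=1$. For infinite $\Gamma$ it induces the metric $d(x,y)=\inf\{|\Gamma:\Gamma_i|^{-1}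 : xy^{-1}\in\Gamma_i\}$ on $\Gamma$. Let $\mathrm{hspec}^{\mathcal N}(\Gamma)$ be the set of Hausdorff dimensions, with respect to this metric, of the closed subgroups of $\Gamma$; let $\mathrm{hspec}^{\mathcal N}_{\mathrm{fg}}(\Gamma)$ be the set of those of the closed subgroups that are topologically finitely generated, and $\mathrm{hspec}^{\mathcal N}_{b}(\Gamma)$ the set of those of the closed subgroups that are topologically generated by at most $b$ elements. For a closed subgroup $\Gamma\le\mathrm{Aut}\,T_m$ let $\mathcal S=\{\mathrm{St}(n)\cap\Gamma\}_{n\ge0}$. For a vertex $v$ let $\mathrm{rist}_\Gamma(v)$ be the subgroup of the elements of $\Gamma$ that fix $v$ and every vertex outside the subtree rooted at $v$, and let $\mathrm{Rist}_\Gamma(k)$ be the product of the groups $\mathrm{rist}_\Gamma(v)$ over all $v$ of level $k$. A filtration $\{\Gamma_i\}$ of $\Gamma$ is *nice* if for every $k\ge1$ and all but finitely many $i$ $$\mathrm{Rist}_\Gamma(k)\Gamma_i/\Gamma_i\;\cong\;\prod_{v\text{ of level }k}\mathrm{rist}_\Gamma(v)\Gamma_i/\Gamma_i .$$ **Theorem.**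 Let $G\le\mathrm{Aut}\,T_m$ be a finitely generated regular branch group, with closure $\overline G$ in $\mathrm{Aut}\,T_m$. Then there exists a natural number $b\ge2$ such that $$\mathrm{hspec}_{b}^{\mathcal S}(\overline G)=\mathrm{hspec}_{\mathrm{fg}}^{\mathcal S}(\overline G)=\mathrm{hspec}^{\mathcal S}(\overline G)=[0,1].$$ Furthermore, if $G$ is also just infinite (that is, $G$ is infinite and each of its non-trivial normal subgroups has finite index), then, with the same $b$, for every nice filtration $\mathcal N$ of $\overline G$ $$\mathrm{hspec}_{b}^{\mathcal N}(\overline G)=\mathrm{hspec}_{\mathrm{fg}}^{\mathcal N}(\overline G)=\mathrm{hspec}^{\mathcal N}(\overline G)=[0,1].$$ -/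

import Mathlib

open scoped ENNReal Topology

/-! ### The `m`-adic rooted tree and its automorphism group -/

/-- Vertices of the `m`-adic tree: finite words in an alphabet with `m` letters. The root is the
empty word and the `n`-th level consists of the words of length `n`. -/
abbrev Vertex (m : ℕ) : Type := List (Fin m)

/-- The `m`-adic tree: `u` and `v` are joined by an edge if one of them is obtained from the other
by appending one letter. -/
def mTree (m : ℕ) : SimpleGraph (Vertex m) where
  Adj u v := (∃ x : Fin m, v = u ++ [x]) ∨ (∃ x : Fin m, u = v ++ [x])
  symm := ⟨fun _ _ h => h.symm⟩
  loopless := ⟨fun u h => by rcases h with ⟨x, h⟩ | ⟨x, h⟩ <;> simp at h⟩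

/-- Bijections of the vertex set that preserve adjacency and fix the root. -/
def treeAutSubgroup (m : ℕ) : Subgroup (Equiv.Perm (Vertex m)) where
  carrier := {g | g [] = [] ∧ ∀ u v, (mTree m).Adj (g u) (g v) ↔ (mTree m).Adj u v}
  one_mem' := ⟨rfl, fun _ _ => Iff.rfl⟩
  mul_mem' := by
    rintro g h ⟨hg, hg'⟩ ⟨hh, hh'⟩
    refine ⟨by simp [hg, hh], fun u v => ?_⟩
    rw [Equiv.Perm.mul_apply, Equiv.Perm.mul_apply, hg', hh']
  inv_mem' := by
    rintro g ⟨hg, hg'⟩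
    refine ⟨by rw [Equiv.Perm.inv_eq_iff_eq, hg], fun u v => ?_⟩
    rw [← hg', show g (g⁻¹ u) = u from g.apply_symm_apply u,
      show g (g⁻¹ v) = v from g.apply_symm_apply v]

/-- The group `Aut T_m`. -/
abbrev TreeAut (m : ℕ) : Type := ↥(treeAutSubgroup m)

namespace TreeAut

variable {m : ℕ}

/-- Automorphisms of the rooted tree preserve the levels and the parent relation. -/
theorem length_and_parent (g : TreeAut m) (u : Vertex m) :
    (g.1 u).length = u.length ∧ ∀ x : Fin m, ∃ y : Fin m, g.1 (u ++ [x]) = g.1 u ++ [y] := by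
  induction u using List.reverseRecOn with
  | nil =>
    refine ⟨by rw [g.2.1], fun x => ?_⟩
    have h : (mTree m).Adj (g.1 []) (g.1 ([] ++ [x])) := (g.2.2 _ _).2 (Or.inl ⟨x, rfl⟩)
    rcases h with ⟨y, h⟩ | ⟨y, h⟩
    · exact ⟨y, h⟩
    · rw [g.2.1] at h
      simp at h
  | append_singleton u z ih =>
    obtain ⟨ihl, ihp⟩ := ih
    obtain ⟨w, hw⟩ := ihp z
    refine ⟨by rw [hw]; simp [ihl], fun x => ?_⟩
    have h : (mTree m).Adj (g.1 (u ++ [z])) (g.1 (u ++ [z] ++ [x])) :=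
      (g.2.2 _ _).2 (Or.inl ⟨x, rfl⟩)
    rcases h with ⟨y, h⟩ | ⟨y, h⟩
    · exact ⟨y, h⟩
    · rw [hw] at h
      have h1 : g.1 u = g.1 (u ++ [z] ++ [x]) := (List.append_inj' h rfl).1
      have h2 := congrArg List.length (g.1.injective h1)
      simp at h2

/-- `St(n)`: the automorphisms that fix every vertex of the `n`-th level. -/
def levelStab (m n : ℕ) : Subgroup (TreeAut m) where
  carrier := {g | ∀ u : Vertex m, u.length = n → g.1 u = u}
  one_mem' := fun _ _ => rfl
  mul_mem' := by
    intro g h hg hh u hu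
    change g.1 (h.1 u) = u
    rw [hh u hu, hg u hu]
  inv_mem' := by
    intro g hg u hu
    change g.1⁻¹ u = u
    rw [Equiv.Perm.inv_eq_iff_eq, hg u hu]

instance levelStab_normal (n : ℕ) : (levelStab m n).Normal where
  conj_mem := by
    intro g hg h u hu
    change h.1 (g.1 ((h⁻¹).1 u)) = u
    rw [hg _ (((length_and_parent h⁻¹ u).1).trans hu)]
    exact h.1.apply_symm_apply u

theorem levelStab_antitone : Antitone (levelStab m) := by
  refine antitone_nat_of_succ_le fun n g hg u hu => ?_
  rcases u with _ | ⟨x, u⟩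
  · exact g.2.1
  · obtain ⟨y, hy⟩ := (length_and_parent g (x :: u)).2 x
    rw [hg _ (by simp only [List.length_append, List.length_singleton, hu])] at hy
    exact ((List.append_inj' hy rfl).1).symm

/-- The congruence topology on `Aut T_m`: the cosets of the level stabilizers form a basis. -/
instance : TopologicalSpace (TreeAut m) where
  IsOpen U := ∀ g ∈ U, ∃ n, ∀ h, g⁻¹ * h ∈ levelStab m n → h ∈ U
  isOpen_univ := fun _ _ => ⟨0, fun _ _ => trivial⟩
  isOpen_inter := by
    rintro U V hU hV g ⟨hgU, hgV⟩
    obtain ⟨n, hn⟩ := hU g hgU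
    obtain ⟨k, hk⟩ := hV g hgV
    exact ⟨max n k, fun h hh => ⟨hn h (levelStab_antitone (le_max_left n k) hh),
      hk h (levelStab_antitone (le_max_right n k) hh)⟩⟩
  isOpen_sUnion := by
    rintro 𝒰 h𝒰 g ⟨U, hU, hgU⟩
    obtain ⟨n, hn⟩ := h𝒰 U hU g hgU
    exact ⟨n, fun h hh => ⟨U, hU, hn h hh⟩⟩

theorem isOpen_coset (g : TreeAut m) (n : ℕ) : IsOpen {h : TreeAut m | g⁻¹ * h ∈ levelStab m n} := by
  intro h hh
  refine ⟨n, fun k hk => ?_⟩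
  have := mul_mem (show g⁻¹ * h ∈ levelStab m n from hh) hk
  simpa [mul_assoc] using this

theorem isOpen_levelStab (n : ℕ) : IsOpen (levelStab m n : Set (TreeAut m)) := by
  simpa using isOpen_coset (1 : TreeAut m) n

instance : IsTopologicalGroup (TreeAut m) where
  continuous_mul := by
    refine continuous_def.2 fun U hU => isOpen_prod_iff.2 fun a b hab => ?_
    obtain ⟨n, hn⟩ := hU (a * b) hab
    refine ⟨_, _, isOpen_coset a n, isOpen_coset b n, by simp [one_mem], by simp [one_mem], ?_⟩
    rintro ⟨c, d⟩ ⟨hc, hd⟩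
    refine hn _ ?_
    have h1 : b⁻¹ * (a⁻¹ * c) * b⁻¹⁻¹ ∈ levelStab m n :=
      (levelStab_normal n).conj_mem _ hc b⁻¹
    have h2 := mul_mem h1 (show b⁻¹ * d ∈ levelStab m n from hd)
    simpa [mul_assoc] using h2
  continuous_inv := by
    refine continuous_def.2 fun U hU a ha => ?_
    obtain ⟨n, hn⟩ := hU a⁻¹ ha
    refine ⟨n, fun b hb => hn _ ?_⟩
    have h1 : a * (a⁻¹ * b)⁻¹ * a⁻¹ ∈ levelStab m n :=
      (levelStab_normal n).conj_mem _ (inv_mem hb) a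
    simpa [mul_assoc] using h1

/-! ### Regular branch groups -/

/-- `h` is the section `g|_v` of `g` at the vertex `v`: `g (v u) = g(v) h(u)` for all words `u`. The
section exists and is unique. -/
def IsSection (g : TreeAut m) (v : Vertex m) (h : TreeAut m) : Prop :=
  ∀ u : Vertex m, g.1 (v ++ u) = g.1 v ++ h.1 u

/-- All sections of elements of `G` lie in `G`. -/
def IsSelfSimilar (G : Subgroup (TreeAut m)) : Prop :=
  ∀ g ∈ G, ∀ v : Vertex m, ∃ h ∈ G, IsSection g v h

/-- `G` acts transitively on every level of the tree. -/
def IsLevelTransitive (G : Subgroup (TreeAut m)) : Prop :=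
  ∀ u v : Vertex m, u.length = v.length → ∃ g ∈ G, g.1 u = v

/-- `ψ(St_K(1)) ≥ K × ⋯ × K`: every tuple of elements of `K` is the tuple of first-level sections
of an element of `K` that fixes the first level. -/
def IsBranching (K : Subgroup (TreeAut m)) : Prop :=
  ∀ k : Fin m → TreeAut m, (∀ x, k x ∈ K) →
    ∃ g ∈ K ⊓ levelStab m 1, ∀ x : Fin m, IsSection g [x] (k x)

/-- Regular branch groups: self-similar, level-transitive, with a branching subgroup of finite
index. -/
def IsRegularBranch (G : Subgroup (TreeAut m)) : Prop :=
  IsSelfSimilar G ∧ IsLevelTransitive G ∧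
    ∃ K : Subgroup (TreeAut m), K ≤ G ∧ (K.subgroupOf G).FiniteIndex ∧ IsBranching K

end TreeAut

/-- A just infinite (discrete) group: infinite, with all proper quotients finite. -/
def IsJustInfinite (G : Type*) [Group G] : Prop :=
  Infinite G ∧ ∀ N : Subgroup G, N.Normal → N ≠ ⊥ → N.FiniteIndex

/-! ### Filtrations and Hausdorff dimension -/

/-- A filtration series of `Γ`: a descending chain `Γ = Γ_0 ≥ Γ_1 ≥ ⋯` of open normal subgroups
with trivial intersection. -/
structure FiltrationSeries (Γ : Type*) [Group Γ] [TopologicalSpace Γ] where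
  /-- The terms of the chain. -/
  seq : ℕ → Subgroup Γ
  zero_eq : seq 0 = ⊤
  anti : Antitone seq
  normal : ∀ i, (seq i).Normal
  isOpen : ∀ i, IsOpen (seq i : Set Γ)
  iInf_eq : ⨅ i, seq i = ⊥

namespace FiltrationSeries

variable {Γ : Type*} [Group Γ] [TopologicalSpace Γ]

instance (F : FiltrationSeries Γ) (i : ℕ) : (F.seq i).Normal := F.normal i

open Classical in
/-- The distance `d(x, y) = inf { |Γ : Γ_i|⁻¹ : x y⁻¹ ∈ Γ_i }`. If `Γ` is an infinite profinite
group, the infimum vanishes for `x = y`, so that the case distinction is immaterial. -/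
noncomputable def filtDist (F : FiltrationSeries Γ) (x y : Γ) : ℝ≥0∞ :=
  if x = y then 0 else ⨅ (i : ℕ) (_ : x * y⁻¹ ∈ F.seq i), ((F.seq i).index : ℝ≥0∞)⁻¹

theorem filtDist_le (F : FiltrationSeries Γ) {x y x' y' : Γ} (h : x' ≠ y')
    (H : ∀ i, x' * y'⁻¹ ∈ F.seq i → x * y⁻¹ ∈ F.seq i) : F.filtDist x y ≤ F.filtDist x' y' := by
  unfold filtDist
  rw [if_neg h]
  split_ifs
  · exact zero_le
  · exact le_iInf₂ fun i hi => iInf₂_le i (H i hi)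

/-- The metric on `Γ` induced by a filtration series. -/
@[reducible]
noncomputable def emetric (F : FiltrationSeries Γ) : EMetricSpace Γ where
  edist := F.filtDist
  edist_self := fun x => if_pos rfl
  edist_comm := by
    intro x y
    by_cases hxy : x = y
    · rw [hxy]
    · refine le_antisymm (F.filtDist_le (Ne.symm hxy) fun i hi => ?_)
        (F.filtDist_le hxy fun i hi => ?_) <;>
      · have := inv_mem hi
        simpa using this
  edist_triangle := by
    intro x y z
    by_cases hxy : x = y
    · rw [hxy]; exact le_add_self
    by_cases hyz : y = z
    · rw [hyz]; exact le_self_add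
    have key : ∀ i, x * y⁻¹ ∈ F.seq i → y * z⁻¹ ∈ F.seq i → x * z⁻¹ ∈ F.seq i := by
      intro i h1 h2
      have := mul_mem h1 h2
      simpa [mul_assoc] using this
    by_cases hs : ∀ i, x * y⁻¹ ∈ F.seq i → y * z⁻¹ ∈ F.seq i
    · exact (F.filtDist_le hxy fun i hi => key i hi (hs i hi)).trans le_self_add
    · push Not at hs
      obtain ⟨j, hj1, hj2⟩ := hs
      refine (F.filtDist_le hyz fun i hi => key i ?_ hi).trans le_add_self
      rcases le_total i j with hij | hij
      · exact F.anti hij hj1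
      · exact absurd (F.anti hij hi) hj2
  eq_of_edist_eq_zero := by
    intro x y h
    by_contra hxy
    have hne : x * y⁻¹ ∉ ⨅ i, F.seq i := by
      rw [F.iInf_eq, Subgroup.mem_bot, mul_inv_eq_one]
      exact hxy
    rw [Subgroup.mem_iInf] at hne
    push Not at hne
    obtain ⟨j, hj⟩ := hne
    change F.filtDist x y = 0 at h
    rw [filtDist, if_neg hxy] at h
    obtain ⟨i₀, -, hi₀⟩ := Finset.exists_min_image (Finset.range (j + 1))
      (fun i => ((F.seq i).index : ℝ≥0∞)⁻¹) ⟨0, by simp⟩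
    have hpos : (0 : ℝ≥0∞) < ((F.seq i₀).index : ℝ≥0∞)⁻¹ :=
      ENNReal.inv_pos.2 (ENNReal.natCast_ne_top _)
    refine absurd h (ne_of_gt (hpos.trans_le (le_iInf₂ fun i hi => hi₀ i ?_)))
    rw [Finset.mem_range]
    by_contra hij
    exact hj (F.anti (by omega) hi)

/-- The Hausdorff dimension of a subset of `Γ` with respect to the metric given by the filtration
series. -/
noncomputable def hdim (F : FiltrationSeries Γ) (s : Set Γ) : ℝ≥0∞ := @dimH Γ F.emetric s

/-- The Hausdorff spectrum of `Γ` restricted to the closed subgroups with the property `P`. -/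
def hspecOf (F : FiltrationSeries Γ) (P : Subgroup Γ → Prop) : Set ℝ≥0∞ :=
  {d | ∃ H : Subgroup Γ, IsClosed (H : Set Γ) ∧ P H ∧ F.hdim (H : Set Γ) = d}

/-- The Hausdorff spectrum. -/
def hspec (F : FiltrationSeries Γ) : Set ℝ≥0∞ := F.hspecOf fun _ => True

/-- The finitely generated Hausdorff spectrum, given by the closed subgroups that are topologically
generated by finitely many elements. -/
def hspecFG (F : FiltrationSeries Γ) : Set ℝ≥0∞ :=
  F.hspecOf fun H => ∃ S : Finset Γ, closure (Subgroup.closure (S : Set Γ) : Set Γ) = (H : Set Γ)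

/-- The `b`-bounded Hausdorff spectrum, given by the closed subgroups that are topologically
generated by at most `b` elements. -/
def hspecBounded (F : FiltrationSeries Γ) (b : ℕ) : Set ℝ≥0∞ :=
  F.hspecOf fun H =>
    ∃ S : Finset Γ, S.card ≤ b ∧ closure (Subgroup.closure (S : Set Γ) : Set Γ) = (H : Set Γ)

end FiltrationSeries

namespace TreeAut

variable {m : ℕ}

/-- The filtration of `Γ ≤ Aut T_m` by its level stabilizers `St_Γ(n) = St(n) ∩ Γ`. -/
def levelStabFiltration (Γ : Subgroup (TreeAut m)) : FiltrationSeries Γ where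
  seq n := (levelStab m n).subgroupOf Γ
  zero_eq := by
    refine eq_top_iff.2 fun g _ u hu => ?_
    rw [List.length_eq_zero_iff.1 hu]
    exact g.1.2.1
  anti := fun _ _ h _ hg => levelStab_antitone h hg
  normal := fun _ => inferInstance
  isOpen := fun n => (isOpen_levelStab n).preimage continuous_subtype_val
  iInf_eq := by
    refine eq_bot_iff.2 fun g hg => ?_
    rw [Subgroup.mem_iInf] at hg
    rw [Subgroup.mem_bot]
    refine Subtype.ext (Subtype.ext (Equiv.ext fun u => ?_))
    exact hg u.length u rfl

/-- The rigid vertex stabilizer `rist_Γ(v)`: the elements of `Γ` that fix `v` and act trivially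
outside the subtree rooted at `v`. -/
def rist (Γ : Subgroup (TreeAut m)) (v : Vertex m) : Subgroup Γ where
  carrier := {g | g.1.1 v = v ∧ ∀ u : Vertex m, ¬ v <+: u → g.1.1 u = u}
  one_mem' := ⟨rfl, fun _ _ => rfl⟩
  mul_mem' := by
    rintro g h ⟨hg, hg'⟩ ⟨hh, hh'⟩
    refine ⟨?_, fun u hu => ?_⟩
    · change g.1.1 (h.1.1 v) = v
      rw [hh, hg]
    · change g.1.1 (h.1.1 u) = u
      rw [hh' u hu, hg' u hu]
  inv_mem' := by
    rintro g ⟨hg, hg'⟩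
    refine ⟨?_, fun u hu => ?_⟩
    · change g.1.1⁻¹ v = v
      rw [Equiv.Perm.inv_eq_iff_eq, hg]
    · change g.1.1⁻¹ u = u
      rw [Equiv.Perm.inv_eq_iff_eq, hg' u hu]

/-- The rigid level stabilizer `Rist_Γ(n)`: the product of the (pairwise commuting) rigid vertex
stabilizers of the vertices of level `n`. -/
def levelRist (Γ : Subgroup (TreeAut m)) (n : ℕ) : Subgroup Γ :=
  ⨆ v : {v : Vertex m // v.length = n}, rist Γ v.1

/-- A filtration series `(Γ_i)` of `Γ` is nice if for every `k ≥ 1` and almost all `i` the group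
`Rist_Γ(k) Γ_i / Γ_i` is isomorphic to the direct product of the groups `rist_Γ(v) Γ_i / Γ_i`, where
`v` runs through the vertices of level `k`. Here `A Γ_i / Γ_i` is the image of `A` in `Γ / Γ_i`. -/
def IsNice (Γ : Subgroup (TreeAut m)) (F : FiltrationSeries Γ) : Prop :=
  ∀ k : ℕ, 1 ≤ k → ∀ᶠ i in Filter.atTop,
    Nonempty (↥((levelRist Γ k).map (QuotientGroup.mk' (F.seq i))) ≃*
      ((v : {v : Vertex m // v.length = k}) → ↥((rist Γ v.1).map (QuotientGroup.mk' (F.seq i)))))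

end TreeAut

/-!
Let `Γ` be the closure of `G` and let `K` be a normal branching subgroup of finite index in `G`.
If `log |HΓᵢ : Γᵢ| / log |Γ : Γᵢ|` converges for a closed subgroup `H ≤ Γ`, then its limit is the
Hausdorff dimension of `H`. For the rigid stabilizer of a vertex of level `k` the limit is `m⁻ᵏ`:
the `mᵏ` rigid stabilizers are conjugate, generate a subgroup of finite index and have independent
images in `Γ ⧸ Γᵢ`.

Given `α ∈ [0, 1]`, let `V` be the set of the shortest words whose `m`-adic intervals lie in
`[0, α]`, and let `T` be a finite transversal of `K` in `G`. Let `H` be topologically generated by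
the elements `δ(k)` that act as `k` below every `v ∈ V`, and, for `t ∈ T`, by the elements `δₜ(k)`
that act below every `v ∈ V` as the copy of `k` at `t v`; here `k` runs over generators of `K`, so
that the number of generators does not depend on `α`. The words `t v` for `v ∈ V` are pairwise
incomparable, so the commutator of `δₜ(x)` with the diagonal copy of an element supported at `t v`
is concentrated below the single vertex `v`. In this way `H` contains the copy of `[K, K]` at the
vertex `v (t v)`, and conjugation by `δ(K)` spreads it to every `v u` with `|u| = |v|`. Hence `H`
acts trivially off the interval `[0, α]` and contains copies of `[K, K]` throughout it.

It remains to see that these copies are asymptotically as large as the rigid stabilizers. If `G`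
is just infinite, then `[K, K]` has finite index in `G`. In the congruence filtration, the
abelianization of the finitely generated group `K` has exponent dividing `(m!)ⁿ` modulo the `n`th
level stabilizer, so it contributes `O(n)` to logarithms that grow faster than `n`.
-/

namespace TreeAut

variable {m : ℕ}

/-! ### Sections and grafting -/

theorem ext_apply {g h : TreeAut m} (H : ∀ u, g.1 u = h.1 u) : g = h :=
  Subtype.ext (Equiv.ext H)

theorem mul_apply (g h : TreeAut m) (u : Vertex m) : (g * h).1 u = g.1 (h.1 u) := rfl

theorem one_apply (u : Vertex m) : (1 : TreeAut m).1 u = u := rfl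

theorem inv_apply_self (g : TreeAut m) (u : Vertex m) : (g⁻¹).1 (g.1 u) = u :=
  g.1.symm_apply_apply u

theorem apply_inv_self (g : TreeAut m) (u : Vertex m) : g.1 ((g⁻¹).1 u) = u :=
  g.1.apply_symm_apply u

theorem length_apply (g : TreeAut m) (u : Vertex m) : (g.1 u).length = u.length :=
  (length_and_parent g u).1

theorem apply_prefix_append (g : TreeAut m) (u w : Vertex m) : g.1 u <+: g.1 (u ++ w) := by
  induction w using List.reverseRecOn with
  | nil => simp
  | append_singleton w x ih =>
    obtain ⟨y, hy⟩ := (length_and_parent g (u ++ w)).2 x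
    rw [← List.append_assoc, hy]
    exact ih.trans (List.prefix_append _ _)

theorem apply_prefix (g : TreeAut m) {u v : Vertex m} (h : u <+: v) : g.1 u <+: g.1 v := by
  obtain ⟨w, rfl⟩ := h
  exact apply_prefix_append g u w

theorem apply_prefix_iff (g : TreeAut m) {u v : Vertex m} : g.1 u <+: g.1 v ↔ u <+: v := by
  refine ⟨fun h => ?_, apply_prefix g⟩
  have := apply_prefix g⁻¹ h
  rwa [inv_apply_self, inv_apply_self] at this

theorem apply_append_drop (g : TreeAut m) (v u : Vertex m) :
    g.1 v ++ (g.1 (v ++ u)).drop v.length = g.1 (v ++ u) := by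
  obtain ⟨w, hw⟩ := apply_prefix_append g v u
  rw [← hw, ← length_apply g v, List.drop_left]

/-- Maps of the vertex set that fix the root and send children of `u` to children of the image
of `u`. -/
def PreservesChildren (f : Vertex m → Vertex m) : Prop :=
  f [] = [] ∧ ∀ u x, ∃ y, f (u ++ [x]) = f u ++ [y]

theorem PreservesChildren.adj {f : Vertex m → Vertex m} (hf : PreservesChildren f) {u v : Vertex m}
    (h : (mTree m).Adj u v) : (mTree m).Adj (f u) (f v) := by
  rcases h with ⟨x, rfl⟩ | ⟨x, rfl⟩
  · exact Or.inl (hf.2 u x)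
  · exact Or.inr (hf.2 v x)

/-- The tree automorphism given by two mutually inverse maps that preserve children. -/
def ofMaps (f f' : Vertex m → Vertex m) (hf : PreservesChildren f) (hf' : PreservesChildren f')
    (hl : Function.LeftInverse f' f) (hr : Function.RightInverse f' f) : TreeAut m :=
  ⟨⟨f, f', hl, hr⟩, hf.1, fun u v => ⟨fun h => by
    have : (mTree m).Adj (f' (f u)) (f' (f v)) := hf'.adj h
    rwa [hl u, hl v] at this, fun h => hf.adj h⟩⟩

theorem preservesChildren_drop (g : TreeAut m) (v w : Vertex m) (h : g.1 v = w) :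
    PreservesChildren fun u => (g.1 (v ++ u)).drop w.length := by
  subst h
  refine ⟨by simp, fun u x => ?_⟩
  obtain ⟨y, hy⟩ := (length_and_parent g (v ++ u)).2 x
  refine ⟨y, ?_⟩
  simp only
  rw [← List.append_assoc, hy, List.drop_append_of_le_length]
  simp [length_apply]

/-- The section `g|_v`. -/
def sec (g : TreeAut m) (v : Vertex m) : TreeAut m :=
  ofMaps (fun u => (g.1 (v ++ u)).drop v.length) (fun u => ((g⁻¹).1 (g.1 v ++ u)).drop v.length)
    (by
      have := preservesChildren_drop g v _ rfl
      rwa [length_apply] at this)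
    (preservesChildren_drop g⁻¹ (g.1 v) v (inv_apply_self g v))
    (fun u => by
      simp only
      rw [apply_append_drop, inv_apply_self, List.drop_left])
    (fun u => by
      have h := apply_append_drop g⁻¹ (g.1 v) u
      rw [inv_apply_self, length_apply] at h
      simp only
      rw [h, apply_inv_self, ← length_apply g v, List.drop_left])

theorem apply_append (g : TreeAut m) (v u : Vertex m) :
    g.1 (v ++ u) = g.1 v ++ (sec g v).1 u :=
  (apply_append_drop g v u).symm

theorem IsSection.eq_sec {g h : TreeAut m} {v : Vertex m} (H : IsSection g v h) : h = sec g v :=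
  ext_apply fun u => List.append_cancel_left ((H u).symm.trans (apply_append g v u))

/-- No word of `V` is a proper prefix of another one. -/
def PrefixFree (V : Set (Vertex m)) : Prop :=
  ∀ ⦃v⦄, v ∈ V → ∀ ⦃w⦄, w ∈ V → v <+: w → v = w

theorem PrefixFree.eq_of_prefix {V : Set (Vertex m)} (hV : PrefixFree V) {v w u : Vertex m}
    (hv : v ∈ V) (hw : w ∈ V) (hvu : v <+: u) (hwu : w <+: u) : v = w := by
  rcases List.prefix_or_prefix_of_prefix hvu hwu with h | h
  · exact hV hv hw h
  · exact (hV hw hv h).symm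

theorem PrefixFree.mono {V W : Set (Vertex m)} (hV : PrefixFree V) (h : W ⊆ V) : PrefixFree W :=
  fun _ hv _ hw => hV (h hv) (h hw)

theorem prefixFree_singleton (w : Vertex m) : PrefixFree {w} := by
  rintro _ rfl _ rfl _
  rfl

theorem prefixFree_of_length {V : Set (Vertex m)} {k : ℕ} (h : ∀ v ∈ V, v.length = k) :
    PrefixFree V := fun _ hv _ hw hvw => hvw.eq_of_length ((h _ hv).trans (h _ hw).symm)

open Classical in
/-- The map that acts as `s v` below each vertex `v` of `V`, and trivially elsewhere. -/
noncomputable def graftFun (V : Set (Vertex m)) (s : Vertex m → TreeAut m) (u : Vertex m) :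
    Vertex m :=
  if h : ∃ v ∈ V, v <+: u then h.choose ++ (s h.choose).1 (u.drop h.choose.length) else u

theorem graftFun_append {V : Set (Vertex m)} (hV : PrefixFree V) (s : Vertex m → TreeAut m)
    {v : Vertex m} (hv : v ∈ V) (u : Vertex m) : graftFun V s (v ++ u) = v ++ (s v).1 u := by
  have h : ∃ w ∈ V, w <+: v ++ u := ⟨v, hv, List.prefix_append _ _⟩
  have h1 : h.choose = v :=
    hV.eq_of_prefix h.choose_spec.1 hv h.choose_spec.2 (List.prefix_append _ _)
  rw [graftFun, dif_pos h, h1, List.drop_left]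

theorem graftFun_of_not {V : Set (Vertex m)} (s : Vertex m → TreeAut m) {u : Vertex m}
    (h : ¬ ∃ v ∈ V, v <+: u) : graftFun V s u = u := dif_neg h

theorem preservesChildren_graftFun {V : Set (Vertex m)} (hV : PrefixFree V)
    (s : Vertex m → TreeAut m) : PreservesChildren (graftFun V s) := by
  constructor
  · by_cases h : ∃ v ∈ V, v <+: ([] : Vertex m)
    · obtain ⟨v, hv, hv'⟩ := h
      obtain rfl := List.prefix_nil.1 hv'
      have := graftFun_append hV s hv []
      simpa [(s []).2.1] using this
    · exact graftFun_of_not s h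
  · intro u x
    by_cases h : ∃ v ∈ V, v <+: u
    · obtain ⟨v, hv, w, rfl⟩ := h
      obtain ⟨y, hy⟩ := (length_and_parent (s v) w).2 x
      refine ⟨y, ?_⟩
      rw [List.append_assoc, graftFun_append hV s hv, graftFun_append hV s hv, hy,
        List.append_assoc]
    · refine ⟨x, ?_⟩
      rw [graftFun_of_not s h]
      by_cases h' : ∃ v ∈ V, v <+: u ++ [x]
      · obtain ⟨v, hv, hv'⟩ := h'
        rcases List.prefix_concat_iff.1 hv' with rfl | h1
        · have := graftFun_append hV s hv []
          simpa [(s _).2.1] using this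
        · exact absurd ⟨v, hv, h1⟩ h
      · exact graftFun_of_not s h'

theorem graftFun_comp {V : Set (Vertex m)} (hV : PrefixFree V) (s t : Vertex m → TreeAut m)
    (u : Vertex m) : graftFun V s (graftFun V t u) = graftFun V (s * t) u := by
  by_cases h : ∃ v ∈ V, v <+: u
  · obtain ⟨v, hv, w, rfl⟩ := h
    simp only [graftFun_append hV _ hv]
    rfl
  · rw [graftFun_of_not t h, graftFun_of_not s h, graftFun_of_not _ h]

theorem graftFun_one {V : Set (Vertex m)} (hV : PrefixFree V) (u : Vertex m) :
    graftFun V 1 u = u := by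
  by_cases h : ∃ v ∈ V, v <+: u
  · obtain ⟨v, hv, w, rfl⟩ := h
    rw [graftFun_append hV _ hv]
    rfl
  · exact graftFun_of_not _ h

/-- The homomorphism that sends a family `s` of automorphisms to the automorphism acting as `s v`
below each vertex `v` of `V`, and trivially elsewhere. -/
noncomputable def graft {V : Set (Vertex m)} (hV : PrefixFree V) :
    (Vertex m → TreeAut m) →* TreeAut m where
  toFun s := ofMaps (graftFun V s) (graftFun V s⁻¹) (preservesChildren_graftFun hV s)
    (preservesChildren_graftFun hV s⁻¹)
    (fun u => by rw [graftFun_comp hV, inv_mul_cancel, graftFun_one hV])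
    (fun u => by rw [graftFun_comp hV, mul_inv_cancel, graftFun_one hV])
  map_one' := ext_apply fun u => graftFun_one hV u
  map_mul' s t := ext_apply fun u => (graftFun_comp hV s t u).symm

theorem graft_apply_append {V : Set (Vertex m)} (hV : PrefixFree V) (s : Vertex m → TreeAut m)
    {v : Vertex m} (hv : v ∈ V) (u : Vertex m) : (graft hV s).1 (v ++ u) = v ++ (s v).1 u :=
  graftFun_append hV s hv u

theorem graft_apply_of_not {V : Set (Vertex m)} (hV : PrefixFree V) (s : Vertex m → TreeAut m)
    {u : Vertex m} (h : ¬ ∃ v ∈ V, v <+: u) : (graft hV s).1 u = u :=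
  graftFun_of_not s h

theorem graft_congr {V : Set (Vertex m)} (hV : PrefixFree V) {s t : Vertex m → TreeAut m}
    (h : ∀ v ∈ V, s v = t v) : graft hV s = graft hV t := by
  refine ext_apply fun u => ?_
  by_cases hu : ∃ v ∈ V, v <+: u
  · obtain ⟨v, hv, w, rfl⟩ := hu
    rw [graft_apply_append hV s hv, graft_apply_append hV t hv, h v hv]
  · rw [graft_apply_of_not hV s hu, graft_apply_of_not hV t hu]

/-- The homomorphism that sends `g` to the automorphism acting as `g` below the vertex `w`, and
trivially elsewhere. -/
noncomputable def place (w : Vertex m) : TreeAut m →* TreeAut m where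
  toFun g := graft (prefixFree_singleton w) fun _ => g
  map_one' := (graft (prefixFree_singleton w)).map_one
  map_mul' g h := (graft (prefixFree_singleton w)).map_mul (fun _ => g) fun _ => h

theorem place_apply_append (w : Vertex m) (g : TreeAut m) (u : Vertex m) :
    (place w g).1 (w ++ u) = w ++ g.1 u :=
  graft_apply_append (prefixFree_singleton w) (fun _ => g) rfl u

theorem place_apply_of_not {w : Vertex m} (g : TreeAut m) {u : Vertex m} (h : ¬ w <+: u) :
    (place w g).1 u = u :=
  graft_apply_of_not (prefixFree_singleton w) (fun _ => g) (by simpa using h)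

theorem place_apply_self (w : Vertex m) (g : TreeAut m) : (place w g).1 w = w := by
  have := place_apply_append w g []
  rwa [g.2.1, List.append_nil] at this

theorem place_injective (w : Vertex m) : Function.Injective (place w) := by
  intro g h H
  refine ext_apply fun u => ?_
  have := place_apply_append w g u
  rw [H, place_apply_append] at this
  exact (List.append_cancel_left this).symm

theorem place_append (v w : Vertex m) (g : TreeAut m) :
    place (v ++ w) g = place v (place w g) := by
  refine ext_apply fun u => ?_
  by_cases hv : v <+: u
  · obtain ⟨u, rfl⟩ := hv
    rw [place_apply_append]
    by_cases hw : w <+: u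
    · obtain ⟨u, rfl⟩ := hw
      rw [place_apply_append, ← List.append_assoc, place_apply_append, List.append_assoc]
    · rw [place_apply_of_not _ hw, place_apply_of_not]
      rwa [List.prefix_append_right_inj]
  · rw [place_apply_of_not _ hv, place_apply_of_not]
    exact fun h => hv ((List.prefix_append v w).trans h)

theorem conj_place (g h : TreeAut m) (w : Vertex m) :
    g * place w h * g⁻¹ = place (g.1 w) (sec g w * h * (sec g w)⁻¹) := by
  rw [mul_inv_eq_iff_eq_mul]
  refine ext_apply fun u => ?_
  rw [mul_apply, mul_apply]
  by_cases hw : w <+: u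
  · obtain ⟨u, rfl⟩ := hw
    rw [place_apply_append, apply_append, apply_append g w u, place_apply_append, mul_apply,
      mul_apply, inv_apply_self]
  · rw [place_apply_of_not _ hw, place_apply_of_not]
    rwa [apply_prefix_iff]

/-- `g` fixes `w` and acts trivially outside the subtree rooted at `w`. -/
def SupportedAt (w : Vertex m) (g : TreeAut m) : Prop :=
  g.1 w = w ∧ ∀ u : Vertex m, ¬ w <+: u → g.1 u = u

theorem supportedAt_place (w : Vertex m) (g : TreeAut m) : SupportedAt w (place w g) :=
  ⟨place_apply_self w g, fun _ h => place_apply_of_not g h⟩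

theorem SupportedAt.eq_place {w : Vertex m} {g : TreeAut m} (h : SupportedAt w g) :
    g = place w (sec g w) := by
  refine ext_apply fun u => ?_
  by_cases hw : w <+: u
  · obtain ⟨u, rfl⟩ := hw
    rw [place_apply_append, apply_append, h.1]
  · rw [place_apply_of_not _ hw, h.2 u hw]

theorem SupportedAt.conj {w : Vertex m} {g : TreeAut m} (hg : SupportedAt w g) (h : TreeAut m) :
    SupportedAt (h.1 w) (h * g * h⁻¹) := by
  rw [hg.eq_place, conj_place]
  exact supportedAt_place _ _

theorem SupportedAt.commute {v w : Vertex m} {g h : TreeAut m} (hg : SupportedAt v g)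
    (hh : SupportedAt w h) (h1 : ¬ v <+: w) (h2 : ¬ w <+: v) : Commute g h := by
  have key : ∀ {v w : Vertex m} {g h : TreeAut m}, SupportedAt v g → SupportedAt w h →
      ¬ v <+: w → ¬ w <+: v → ∀ u, v <+: u → g.1 (h.1 u) = h.1 (g.1 u) := by
    intro v w g h hg hh h1 h2 u hu
    have h3 : ∀ u, v <+: u → ¬ w <+: u := fun u hu hw =>
      (List.prefix_or_prefix_of_prefix hu hw).elim h1 h2
    have h4 : v <+: g.1 u := by
      have := apply_prefix g hu
      rwa [hg.1] at this
    rw [hh.2 u (h3 u hu), hh.2 _ (h3 _ h4)]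
  refine ext_apply fun u => ?_
  rw [mul_apply, mul_apply]
  by_cases hv : v <+: u
  · exact key hg hh h1 h2 u hv
  by_cases hw : w <+: u
  · exact (key hh hg h2 h1 u hw).symm
  rw [hg.2 u hv, hh.2 u hw, hg.2 u hv]

theorem place_mem_levelStab {w : Vertex m} {g : TreeAut m} {n : ℕ} :
    place w g ∈ levelStab m (w.length + n) ↔ g ∈ levelStab m n := by
  constructor
  · intro h u hu
    have := h (w ++ u) (by rw [List.length_append, hu])
    rw [place_apply_append] at this
    exact List.append_cancel_left this
  · intro h u hu
    by_cases hw : w <+: u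
    · obtain ⟨u, rfl⟩ := hw
      rw [place_apply_append, h u (by rw [List.length_append] at hu; omega)]
    · exact place_apply_of_not g hw

theorem sec_mem_levelStab {g : TreeAut m} {k n : ℕ} (hg : g ∈ levelStab m (k + n)) {w : Vertex m}
    (hw : w.length = k) : sec g w ∈ levelStab m n := by
  intro u hu
  have h1 := hg (w ++ u) (by rw [List.length_append, hw, hu])
  rw [apply_append, levelStab_antitone (Nat.le_add_right k n) hg w hw] at h1
  exact List.append_cancel_left h1

end TreeAut

/-! ### Finite index and closures -/

theorem exists_finset_cover_of_relIndex_ne_zero {A : Type*} [Group A] {K G : Subgroup A}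
    (h : K.relIndex G ≠ 0) :
    ∃ T : Finset A, (∀ t ∈ T, t ∈ G) ∧ ∀ g ∈ G, ∃ t ∈ T, t⁻¹ * g ∈ K := by
  classical
  have : Finite (G ⧸ K.subgroupOf G) := Nat.finite_of_card_ne_zero h
  have := Fintype.ofFinite (G ⧸ K.subgroupOf G)
  refine ⟨Finset.univ.image fun q : G ⧸ K.subgroupOf G => (q.out : A), ?_, fun g hg => ?_⟩
  · simp only [Finset.mem_image, Finset.mem_univ, true_and, forall_exists_index,
      forall_apply_eq_imp_iff]
    exact fun q => q.out.2
  · let q : G ⧸ K.subgroupOf G := QuotientGroup.mk ⟨g, hg⟩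
    have hq : q.out⁻¹ * ⟨g, hg⟩ ∈ K.subgroupOf G := QuotientGroup.eq.1 (QuotientGroup.out_eq' q)
    exact ⟨_, Finset.mem_image_of_mem _ (Finset.mem_univ q), hq⟩

theorem relIndex_topologicalClosure_ne_zero {A : Type*} [Group A] [TopologicalSpace A]
    [IsTopologicalGroup A] {K G : Subgroup A} (h : K.relIndex G ≠ 0) :
    K.topologicalClosure.relIndex G.topologicalClosure ≠ 0 := by
  obtain ⟨T, hTG, hT⟩ := exists_finset_cover_of_relIndex_ne_zero h
  have hcl : IsClosed (⋃ t ∈ T, {g : A | t⁻¹ * g ∈ K.topologicalClosure}) :=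
    T.finite_toSet.isClosed_biUnion fun t _ =>
      K.isClosed_topologicalClosure.preimage (continuous_const_mul t⁻¹)
  have hsub : (G.topologicalClosure : Set A) ⊆
      ⋃ t ∈ T, {g : A | t⁻¹ * g ∈ K.topologicalClosure} := by
    refine closure_minimal (fun g hg => ?_) hcl
    obtain ⟨t, ht, htg⟩ := hT g hg
    exact Set.mem_biUnion ht (K.le_topologicalClosure htg)
  have : Finite (G.topologicalClosure ⧸ K.topologicalClosure.subgroupOf G.topologicalClosure) := by
    refine Finite.of_surjective (fun t : T => QuotientGroup.mk
      (⟨t.1, G.le_topologicalClosure (hTG t.1 t.2)⟩ : G.topologicalClosure)) fun q => ?_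
    obtain ⟨g, rfl⟩ := QuotientGroup.mk_surjective q
    obtain ⟨t, ht, htg⟩ := Set.mem_iUnion₂.1 (hsub g.2)
    exact ⟨⟨t, ht⟩, QuotientGroup.eq.2 htg⟩
  exact Nat.card_pos.ne'

namespace TreeAut

variable {m : ℕ}

/-! ### The congruence topology -/

theorem inv_mul_mem_levelStab_iff {g h : TreeAut m} {n : ℕ} :
    g⁻¹ * h ∈ levelStab m n ↔ ∀ u : Vertex m, u.length = n → h.1 u = g.1 u := by
  refine forall₂_congr fun u _ => ?_
  rw [mul_apply]
  constructor
  · intro H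
    rw [← apply_inv_self g (h.1 u), H]
  · intro H
    rw [H, inv_apply_self]

theorem apply_eq_of_le {g h : TreeAut m} {n : ℕ} (H : ∀ u : Vertex m, u.length = n → h.1 u = g.1 u)
    {u : Vertex m} (hu : u.length ≤ n) : h.1 u = g.1 u :=
  inv_mul_mem_levelStab_iff.1 (levelStab_antitone hu (inv_mul_mem_levelStab_iff.2 H)) u rfl

theorem mem_closure_iff {s : Set (TreeAut m)} {g : TreeAut m} :
    g ∈ closure s ↔ ∀ n, ∃ h ∈ s, ∀ u : Vertex m, u.length = n → h.1 u = g.1 u := by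
  constructor
  · intro hg n
    obtain ⟨h, h1, h2⟩ := _root_.mem_closure_iff.1 hg _ (isOpen_coset g n) (by simp [one_mem])
    exact ⟨h, h2, inv_mul_mem_levelStab_iff.1 h1⟩
  · intro H
    refine _root_.mem_closure_iff.2 fun U hU hgU => ?_
    obtain ⟨n, hn⟩ := hU g hgU
    obtain ⟨h, h1, h2⟩ := H n
    exact ⟨h, hn h (inv_mul_mem_levelStab_iff.2 h2), h1⟩

theorem mem_topologicalClosure_iff {G : Subgroup (TreeAut m)} {g : TreeAut m} :
    g ∈ G.topologicalClosure ↔ ∀ n, ∃ h ∈ G, ∀ u : Vertex m, u.length = n → h.1 u = g.1 u :=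
  mem_closure_iff

theorem continuous_place (w : Vertex m) : Continuous (place w) := by
  refine continuous_def.2 fun U hU g hg => ?_
  obtain ⟨n, hn⟩ := hU _ hg
  refine ⟨n, fun h hh => hn _ ?_⟩
  rw [← map_inv, ← map_mul]
  exact levelStab_antitone (Nat.le_add_left n w.length) (place_mem_levelStab.2 hh)

theorem isClosed_fixing (u : Vertex m) : IsClosed {g : TreeAut m | g.1 u = u} := by
  rw [← closure_subset_iff_isClosed]
  intro g hg
  obtain ⟨h, h1, h2⟩ := mem_closure_iff.1 hg u.length
  exact (h2 u rfl).symm.trans h1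

theorem exists_eventually_apply_eq (f : Ultrafilter (TreeAut m)) (φ : TreeAut m → TreeAut m)
    (u : Vertex m) : ∃ w : Vertex m, ∀ᶠ g in (f : Filter (TreeAut m)), (φ g).1 u = w := by
  have h := (Ultrafilter.finite_biUnion_mem_iff (f := f)
    (s := fun w : Vertex m => {g : TreeAut m | (φ g).1 u = w})
    (List.finite_length_eq (Fin m) u.length)).1
    (Filter.mem_of_superset Filter.univ_mem fun g _ =>
      Set.mem_biUnion (x := (φ g).1 u) (length_apply (φ g) u) rfl)
  exact h.imp fun w hw => hw.2

instance : CompactSpace (TreeAut m) := by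
  refine ⟨isCompact_iff_ultrafilter_le_nhds.2 fun f _ => ?_⟩
  choose φ hφ using exists_eventually_apply_eq f id
  choose ψ hψ using exists_eventually_apply_eq f fun g => g⁻¹
  have pres : ∀ (σ : TreeAut m → TreeAut m) (χ : Vertex m → Vertex m),
      (∀ u, ∀ᶠ g in (f : Filter (TreeAut m)), (σ g).1 u = χ u) → PreservesChildren χ := by
    intro σ χ h
    refine ⟨?_, fun u x => ?_⟩
    · obtain ⟨g, hg⟩ := (h []).exists
      rw [← hg, (σ g).2.1]
    · obtain ⟨g, hg, hg'⟩ := ((h u).and (h (u ++ [x]))).exists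
      rw [← hg, ← hg']
      exact (length_and_parent (σ g) u).2 x
  let g₀ : TreeAut m := ofMaps φ ψ (pres _ _ hφ) (pres _ _ hψ)
    (fun u => by
      obtain ⟨g, hg, hg'⟩ := ((hφ u).and (hψ (φ u))).exists
      rw [← hg', ← hg]
      exact inv_apply_self g u)
    (fun u => by
      obtain ⟨g, hg, hg'⟩ := ((hψ u).and (hφ (ψ u))).exists
      rw [← hg', ← hg]
      exact apply_inv_self g u)
  refine ⟨g₀, trivial, fun U hU => ?_⟩
  obtain ⟨W, hWU, hW, hgW⟩ := mem_nhds_iff.1 hU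
  obtain ⟨n, hn⟩ := hW g₀ hgW
  have h1 : ∀ᶠ g in (f : Filter (TreeAut m)), ∀ u ∈ {u : Vertex m | u.length = n}, g.1 u = φ u :=
    (List.finite_length_eq (Fin m) n).eventually_all.2 fun u _ => hφ u
  exact h1.mono fun g hg => hWU (hn g (inv_mul_mem_levelStab_iff.2 hg))

end TreeAut

/-! ### Hausdorff dimension and logarithmic indices -/

section HausdorffDimension

open MeasureTheory Metric Filter
open scoped Pointwise

theorem le_dimH_of_measure_le {X : Type*} [EMetricSpace X] [MeasurableSpace X] [BorelSpace X]
    {μ : Measure X} {s : Set X} (hs : μ s ≠ 0) {d : NNReal} {ε : ℝ≥0∞} (hε : 0 < ε)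
    (h : ∀ t : Set X, ediam t ≤ ε → μ t ≤ ediam t ^ (d : ℝ)) : (d : ℝ≥0∞) ≤ dimH s :=
  le_dimH_of_hausdorffMeasure_ne_zero
    (ne_of_gt ((pos_iff_ne_zero.2 hs).trans_le (Measure.le_hausdorffMeasure _ μ ε hε h s)))

theorem dimH_le_of_frequently_cover {X : Type*} [EMetricSpace X] {s : Set X} {d : NNReal}
    {δ : ℕ → ℝ≥0∞} (hδ : Tendsto δ atTop (𝓝 0)) {ι : ℕ → Type*} [∀ n, Fintype (ι n)]
    (t : ∀ n, ι n → Set X) (ht : ∀ n i, ediam (t n i) ≤ δ n) (hst : ∀ n, s ⊆ ⋃ i, t n i)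
    (h : ∃ᶠ n in atTop, (Fintype.card (ι n) : ℝ≥0∞) * δ n ^ (d : ℝ) ≤ 1) :
    dimH s ≤ d := by
  borelize X
  refine dimH_le_of_hausdorffMeasure_ne_top (ne_top_of_le_ne_top ENNReal.one_ne_top ?_)
  refine (Measure.hausdorffMeasure_le_liminf_sum _ s δ hδ t (Eventually.of_forall ht)
    (Eventually.of_forall hst)).trans (liminf_le_of_frequently_le' (h.mono fun n hn => ?_))
  calc ∑ i, ediam (t n i) ^ (d : ℝ)
      ≤ ∑ _i : ι n, δ n ^ (d : ℝ) :=
        Finset.sum_le_sum fun i _ => ENNReal.rpow_le_rpow (ht n i) d.2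
    _ ≤ 1 := by simpa using hn

theorem exists_measure_leftCoset_le {Γ : Type*} [Group Γ] [TopologicalSpace Γ]
    [IsTopologicalGroup Γ] [CompactSpace Γ] [MeasurableSpace Γ] [BorelSpace Γ] {H : Subgroup Γ}
    (hH : IsClosed (H : Set Γ)) :
    ∃ μ : Measure Γ, μ H = 1 ∧ ∀ N : Subgroup Γ, IsOpen (N : Set Γ) → ∀ x : Γ,
      μ (x • (N : Set Γ)) ≤ (N.relIndex H : ℝ≥0∞)⁻¹ := by
  have : CompactSpace H := isCompact_iff_compactSpace.1 hH.isCompact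
  let ν : Measure H := Measure.haarMeasure ⊤
  have hν : ν Set.univ = 1 := Measure.haarMeasure_self
  refine ⟨ν.map (↑), ?_, fun N hN x => ?_⟩
  · rwa [Measure.map_apply measurable_subtype_coe hH.measurableSet, Subtype.coe_preimage_self]
  rw [Measure.map_apply measurable_subtype_coe (hN.smul x).measurableSet]
  rcases Set.eq_empty_or_nonempty (((↑) : H → Γ) ⁻¹' (x • (N : Set Γ))) with hempty | ⟨z, hz⟩
  · rw [hempty, measure_empty]
    exact zero_le
  have hcoset : ((↑) : H → Γ) ⁻¹' (x • (N : Set Γ)) = z • (N.subgroupOf H : Set H) := by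
    rw [(leftCoset_eq_iff N).2 ((mem_leftCoset_iff x).1 hz)]
    ext y
    rw [Set.mem_preimage, mem_leftCoset_iff, mem_leftCoset_iff]
    rfl
  have hopen : IsOpen (N.subgroupOf H : Set H) := hN.preimage continuous_subtype_val
  have := (N.subgroupOf H).quotient_finite_of_isOpen hopen
  have : (N.subgroupOf H).FiniteIndex := Subgroup.finiteIndex_of_finite_quotient
  have hindex := (N.subgroupOf H).index_mul_measure hopen.measurableSet ν
  rw [hcoset, measure_smul, ENNReal.le_inv_iff_mul_le, mul_comm]
  exact (hindex.trans hν).le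

theorem topologicalSpace_eq_of_continuous_id {X : Type*} {τ τ' : TopologicalSpace X}
    [@CompactSpace X τ] [@T2Space X τ'] (h : @Continuous X X τ τ' id) : τ = τ' :=
  have hemb := @Continuous.isClosedEmbedding X X τ τ' _ _ id h Function.injective_id
  (@Topology.IsInducing.eq_induced X X τ τ' id (@hemb.isInducing)).trans induced_id

namespace FiltrationSeries

variable {Γ : Type*} [Group Γ] [TopologicalSpace Γ]

theorem filtDist_le_of_mem (F : FiltrationSeries Γ) {x y : Γ} {i : ℕ} (h : x * y⁻¹ ∈ F.seq i) :
    F.filtDist x y ≤ ((F.seq i).index : ℝ≥0∞)⁻¹ := by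
  unfold filtDist
  split_ifs
  · exact zero_le
  · exact iInf₂_le i h

variable [IsTopologicalGroup Γ] [CompactSpace Γ]

instance finiteIndex_seq (F : FiltrationSeries Γ) (i : ℕ) : (F.seq i).FiniteIndex :=
  have := (F.seq i).quotient_finite_of_isOpen (F.isOpen i)
  Subgroup.finiteIndex_of_finite_quotient

theorem index_mono (F : FiltrationSeries Γ) : Monotone fun i => (F.seq i).index :=
  fun _ _ hij => Subgroup.index_antitone (F.anti hij)

theorem inv_index_le_filtDist_of_notMem (F : FiltrationSeries Γ) {x y : Γ} {i : ℕ}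
    (h : x * y⁻¹ ∉ F.seq (i + 1)) : ((F.seq i).index : ℝ≥0∞)⁻¹ ≤ F.filtDist x y := by
  have hxy : x ≠ y := by
    rintro rfl
    exact h (by simp [one_mem])
  unfold filtDist
  rw [if_neg hxy]
  refine le_iInf₂ fun j hj => ENNReal.inv_le_inv.2 (Nat.cast_le.2 (F.index_mono ?_))
  by_contra hij
  exact h (F.anti (by omega) hj)

theorem tendsto_index [Infinite Γ] (F : FiltrationSeries Γ) :
    Tendsto (fun i => (F.seq i).index) atTop atTop := by
  refine tendsto_atTop_atTop_of_monotone F.index_mono fun b => ?_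
  by_contra! hb
  obtain ⟨_, ⟨i, rfl⟩, hi⟩ := Set.exists_max_image (Set.range fun i => (F.seq i).index) id
    ((Set.finite_lt_nat b).subset (Set.range_subset_iff.2 hb)) (Set.range_nonempty _)
  have hle : ∀ j, F.seq i ≤ F.seq j := by
    intro j
    rcases le_total j i with h | h
    · exact F.anti h
    · by_contra hnot
      exact (Subgroup.index_strictAnti ((F.anti h).lt_of_not_ge hnot)).not_ge (hi _ ⟨j, rfl⟩)
  have hbot : F.seq i = ⊥ := le_bot_iff.1 (F.iInf_eq ▸ le_iInf hle)
  have hindex := (F.seq i).index_ne_zero_of_finite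
  rw [hbot, Subgroup.index_bot] at hindex
  exact hindex Nat.card_eq_zero_of_infinite

theorem tendsto_inv_index [Infinite Γ] (F : FiltrationSeries Γ) :
    Tendsto (fun i => ((F.seq i).index : ℝ≥0∞)⁻¹) atTop (𝓝 0) :=
  ENNReal.inv_top ▸ tendsto_inv_iff.2 (ENNReal.tendsto_nat_nhds_top.comp F.tendsto_index)

theorem toTopologicalSpace_emetric [Infinite Γ] (F : FiltrationSeries Γ) :
    F.emetric.toUniformSpace.toTopologicalSpace = ‹TopologicalSpace Γ› := by
  have hcont : @Continuous Γ Γ _ F.emetric.toUniformSpace.toTopologicalSpace id := by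
    refine @continuous_iff_continuousAt _ _ _ (_) _ |>.2 fun x => ?_
    refine (@EMetric.tendsto_nhds _ _ F.emetric.toPseudoEMetricSpace _ _ _).2 fun ε hε => ?_
    obtain ⟨i, hi⟩ := (F.tendsto_inv_index.eventually_lt_const hε).exists
    have hmem : {y | y * x⁻¹ ∈ F.seq i} ∈ 𝓝 x :=
      ((F.isOpen i).preimage (continuous_mul_const x⁻¹)).mem_nhds (by simp [one_mem])
    filter_upwards [hmem] with y hy
    exact (F.filtDist_le_of_mem hy).trans_lt hi
  have hT2 : @T2Space Γ F.emetric.toUniformSpace.toTopologicalSpace :=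
    letI := F.emetric
    inferInstance
  exact (topologicalSpace_eq_of_continuous_id hcont).symm

theorem exists_subset_leftCoset (F : FiltrationSeries Γ) {U : Set Γ} (hU : U.Nontrivial) :
    ∃ (i : ℕ) (x : Γ), U ⊆ x • (F.seq i : Set Γ) ∧
      ((F.seq i).index : ℝ≥0∞)⁻¹ ≤ @ediam Γ F.emetric.toPseudoEMetricSpace U := by
  classical
  obtain ⟨x, hx, y, hy, hxy⟩ := hU
  have hsep : ∃ i, ¬ U ⊆ x • (F.seq i : Set Γ) := by
    by_contra! hall
    refine hxy (inv_mul_eq_one.1 ?_)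
    rw [← Subgroup.mem_bot, ← F.iInf_eq, Subgroup.mem_iInf]
    exact fun i => (mem_leftCoset_iff x).1 (hall i hy)
  have hne : Nat.find hsep ≠ 0 := fun h0 => Nat.find_spec hsep (by simp [h0, F.zero_eq])
  obtain ⟨i, hi⟩ := Nat.exists_eq_succ_of_ne_zero hne
  refine ⟨i, x, not_not.1 (Nat.find_min hsep (by omega)), ?_⟩
  obtain ⟨z, hz, hzx⟩ := Set.not_subset.1 (hi ▸ Nat.find_spec hsep)
  have hzx' : z * x⁻¹ ∉ F.seq (i + 1) := fun h =>
    hzx ((mem_leftCoset_iff x).2 ((F.normal (i + 1)).mem_comm h))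
  exact (F.inv_index_le_filtDist_of_notMem hzx').trans
    (@edist_le_ediam_of_mem Γ _ _ _ F.emetric.toPseudoEMetricSpace hz hx)

theorem relIndex_ne_zero (F : FiltrationSeries Γ) (i : ℕ) (H : Subgroup Γ) :
    (F.seq i).relIndex H ≠ 0 :=
  mt Subgroup.index_eq_zero_of_relIndex_eq_zero (F.seq i).index_ne_zero_of_finite

theorem hdim_le_of_frequently [Infinite Γ] (F : FiltrationSeries Γ) {H : Subgroup Γ} {s : NNReal}
    (h : ∃ᶠ i in atTop, ((F.seq i).relIndex H : ℝ≥0∞) ≤ ((F.seq i).index : ℝ≥0∞) ^ (s : ℝ)) :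
    F.hdim (H : Set Γ) ≤ s := by
  have : ∀ i, Finite (H ⧸ (F.seq i).subgroupOf H) := fun i =>
    Nat.finite_of_card_ne_zero (F.relIndex_ne_zero i H)
  let : ∀ i, Fintype (H ⧸ (F.seq i).subgroupOf H) := fun i => Fintype.ofFinite _
  refine @dimH_le_of_frequently_cover Γ F.emetric (H : Set Γ) s _ F.tendsto_inv_index
    (fun i => H ⧸ (F.seq i).subgroupOf H) _
    (fun i q => {x | ∃ y : H, (y : Γ) = x ∧ (QuotientGroup.mk y : H ⧸ _) = q}) ?_ ?_ ?_
  · intro i q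
    refine @ediam_le Γ _ F.emetric.toPseudoEMetricSpace _ ?_
    rintro _ ⟨x, rfl, hx⟩ _ ⟨y, rfl, hy⟩
    have hyx : y⁻¹ * x ∈ (F.seq i).subgroupOf H := QuotientGroup.eq.1 (hy.trans hx.symm)
    exact F.filtDist_le_of_mem ((F.normal i).mem_comm hyx)
  · exact fun i x hx => Set.mem_iUnion.2 ⟨QuotientGroup.mk ⟨x, hx⟩, ⟨x, hx⟩, rfl, rfl⟩
  · refine h.mono fun i hi => ?_
    rw [← Nat.card_eq_fintype_card, ENNReal.inv_rpow]
    exact (mul_le_mul_left hi _).trans (ENNReal.mul_inv_le_one _)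

theorem le_hdim_of_eventually [Infinite Γ] (F : FiltrationSeries Γ) {H : Subgroup Γ}
    (hH : IsClosed (H : Set Γ)) {s : NNReal}
    (h : ∀ᶠ i in atTop, ((F.seq i).index : ℝ≥0∞) ^ (s : ℝ) ≤ ((F.seq i).relIndex H : ℝ≥0∞)) :
    s ≤ F.hdim (H : Set Γ) := by
  rcases eq_or_ne s 0 with rfl | hs
  · exact zero_le
  borelize Γ
  obtain ⟨μ, hμH, hμ⟩ := exists_measure_leftCoset_le hH
  obtain ⟨i₀, hi₀⟩ := eventually_atTop.1 h
  obtain ⟨ε, hε, hε'⟩ := exists_between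
    (ENNReal.inv_pos.2 (ENNReal.natCast_ne_top (F.seq i₀).index))
  have hbig : ∀ i ≥ i₀, ∀ x, μ (x • (F.seq i : Set Γ)) ≤ ((F.seq i).index : ℝ≥0∞)⁻¹ ^ (s : ℝ) :=
    fun i hi x => (hμ _ (F.isOpen i) x).trans (by
      rw [ENNReal.inv_rpow]
      exact ENNReal.inv_le_inv.2 (hi₀ i hi))
  have hsmall : Tendsto (fun i => ((F.seq i).index : ℝ≥0∞)⁻¹ ^ (s : ℝ)) atTop (𝓝 0) := by
    simpa [pos_iff_ne_zero.2 hs] using F.tendsto_inv_index.ennrpow_const (s : ℝ)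
  have hsingleton : ∀ x, μ {x} = 0 := fun x => le_zero_iff.1 <| ge_of_tendsto hsmall <| by
    filter_upwards [eventually_ge_atTop i₀] with i hi
    refine (measure_mono (Set.singleton_subset_iff.2 ?_)).trans (hbig i hi x)
    exact (mem_leftCoset_iff x).2 (by simp [one_mem])
  refine @le_dimH_of_measure_le Γ F.emetric _ ?_ μ H (by simp [hμH]) s ε hε fun U hU => ?_
  · rw [F.toTopologicalSpace_emetric]
    infer_instance
  rcases U.subsingleton_or_nontrivial with hU' | hU'
  · rcases hU'.eq_empty_or_singleton with rfl | ⟨x, rfl⟩ <;> simp [hsingleton]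
  obtain ⟨i, x, hUi, hi⟩ := F.exists_subset_leftCoset hU'
  have hi₀i : i₀ ≤ i := by
    by_contra! hlt
    exact hε'.not_ge ((ENNReal.inv_le_inv.2 (Nat.cast_le.2 (F.index_mono hlt.le))).trans
      (hi.trans hU))
  exact (measure_mono hUi).trans ((hbig i hi₀i x).trans (ENNReal.rpow_le_rpow hi s.2))

/-! ### Logarithmic indices -/

section LogIndexRatio

variable {Γ : Type*} [Group Γ] [TopologicalSpace Γ]

/-- The ratio `log |H Γ_i : Γ_i| / log |Γ : Γ_i|`, with the value `0` when `Γ_i = Γ`. By Barnea and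
Shalev its lower limit is the Hausdorff dimension of a closed subgroup `H`. -/
noncomputable def logIndexRatio (F : FiltrationSeries Γ) (H : Subgroup Γ) (i : ℕ) : ℝ :=
  Real.log ((F.seq i).relIndex H) / Real.log (F.seq i).index

variable [IsTopologicalGroup Γ] [CompactSpace Γ] (F : FiltrationSeries Γ)

theorem relIndex_mono {H K : Subgroup Γ} (h : H ≤ K) (i : ℕ) :
    (F.seq i).relIndex H ≤ (F.seq i).relIndex K :=
  Subgroup.relIndex_le_of_le_right h (F.relIndex_ne_zero i K)

theorem relIndex_le_index (H : Subgroup Γ) (i : ℕ) : (F.seq i).relIndex H ≤ (F.seq i).index :=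
  (F.relIndex_mono le_top i).trans_eq (F.seq i).relIndex_top_right

theorem relIndex_pos (H : Subgroup Γ) (i : ℕ) : (0 : ℝ) < (F.seq i).relIndex H :=
  Nat.cast_pos.2 (Nat.pos_of_ne_zero (F.relIndex_ne_zero i H))

theorem index_pos (i : ℕ) : (0 : ℝ) < (F.seq i).index :=
  Nat.cast_pos.2 (Nat.pos_of_ne_zero (F.seq i).index_ne_zero_of_finite)

theorem logIndexRatio_mono {H K : Subgroup Γ} (h : H ≤ K) (i : ℕ) :
    F.logIndexRatio H i ≤ F.logIndexRatio K i :=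
  div_le_div_of_nonneg_right
    (Real.log_le_log (F.relIndex_pos H i) (Nat.cast_le.2 (F.relIndex_mono h i)))
    (Real.log_natCast_nonneg _)

theorem logIndexRatio_le_one (H : Subgroup Γ) (i : ℕ) : F.logIndexRatio H i ≤ 1 :=
  div_le_one_of_le₀
    (Real.log_le_log (F.relIndex_pos H i) (Nat.cast_le.2 (F.relIndex_le_index H i)))
    (Real.log_natCast_nonneg _)

theorem log_relIndex_eq (H : Subgroup Γ) (i : ℕ) :
    Real.log ((F.seq i).relIndex H) = F.logIndexRatio H i * Real.log (F.seq i).index := by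
  rcases eq_or_ne (Real.log (F.seq i).index) 0 with h | h
  · rw [h, mul_zero]
    exact le_antisymm ((Real.log_le_log (F.relIndex_pos H i)
      (Nat.cast_le.2 (F.relIndex_le_index H i))).trans_eq h) (Real.log_natCast_nonneg _)
  · exact (div_mul_cancel₀ _ h).symm

theorem relIndex_eq_rpow (H : Subgroup Γ) (i : ℕ) :
    ((F.seq i).relIndex H : ℝ≥0∞) = ((F.seq i).index : ℝ≥0∞) ^ F.logIndexRatio H i := by
  have h : ((F.seq i).relIndex H : ℝ) = ((F.seq i).index : ℝ) ^ F.logIndexRatio H i := by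
    rw [Real.rpow_def_of_pos (F.index_pos i), mul_comm, ← F.log_relIndex_eq,
      Real.exp_log (F.relIndex_pos H i)]
  rw [← ENNReal.ofReal_natCast, h, ← ENNReal.ofReal_rpow_of_pos (F.index_pos i),
    ENNReal.ofReal_natCast]

theorem one_le_index (i : ℕ) : (1 : ℝ≥0∞) ≤ (F.seq i).index :=
  Nat.one_le_cast.2 (Nat.one_le_iff_ne_zero.2 (F.seq i).index_ne_zero_of_finite)

theorem hdim_eq_of_tendsto [Infinite Γ] {H : Subgroup Γ} (hH : IsClosed (H : Set Γ)) {α : ℝ}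
    (h : Tendsto (F.logIndexRatio H) atTop (𝓝 α)) : F.hdim (H : Set Γ) = ENNReal.ofReal α := by
  refine le_antisymm (ENNReal.le_of_forall_pos_le_add fun ε hε _ => ?_)
    (ENNReal.le_of_forall_nnreal_lt fun s hs => ?_)
  · have hα : α < (α.toNNReal + ε : NNReal) :=
      (Real.le_coe_toNNReal α).trans_lt (by simpa using hε)
    refine F.hdim_le_of_frequently (s := α.toNNReal + ε)
      ((h.eventually_le_const hα).frequently.mono fun i hi => ?_)
    rw [F.relIndex_eq_rpow]
    exact ENNReal.rpow_le_rpow_of_exponent_le (F.one_le_index i) hi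
  · have hα : (s : ℝ) < α := Real.lt_toNNReal_iff_coe_lt.1 (ENNReal.coe_lt_coe.1 hs)
    refine F.le_hdim_of_eventually hH ((h.eventually_const_le hα).mono fun i hi => ?_)
    rw [F.relIndex_eq_rpow]
    exact ENNReal.rpow_le_rpow_of_exponent_le (F.one_le_index i) hi

theorem hdim_le_one [Infinite Γ] (H : Subgroup Γ) : F.hdim (H : Set Γ) ≤ 1 := by
  refine F.hdim_le_of_frequently (s := 1) (Frequently.of_forall fun i => ?_)
  simpa using F.relIndex_le_index H i

theorem tendsto_log_index [Infinite Γ] :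
    Tendsto (fun i => Real.log (F.seq i).index) atTop atTop :=
  Real.tendsto_log_atTop.comp (tendsto_natCast_atTop_atTop.comp F.tendsto_index)

theorem tendsto_const_div_log_index [Infinite Γ] (c : ℝ) :
    Tendsto (fun i => c / Real.log (F.seq i).index) atTop (𝓝 0) :=
  F.tendsto_log_index.const_div_atTop c

theorem tendsto_logIndexRatio_top [Infinite Γ] : Tendsto (F.logIndexRatio ⊤) atTop (𝓝 1) := by
  refine tendsto_const_nhds.congr' ?_
  filter_upwards [F.tendsto_log_index.eventually_ne_atTop 0] with i hi
  rw [logIndexRatio, Subgroup.relIndex_top_right, div_self hi]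

theorem sum_logIndexRatio_le {ι : Type*} {t : Finset ι} {P : ι → Subgroup Γ} {H : Subgroup Γ}
    {i : ℕ} (h : ∏ j ∈ t, (F.seq i).relIndex (P j) ≤ (F.seq i).relIndex H) :
    ∑ j ∈ t, F.logIndexRatio (P j) i ≤ F.logIndexRatio H i := by
  simp only [logIndexRatio]
  rw [← Finset.sum_div, ← Real.log_prod fun j _ => (F.relIndex_pos (P j) i).ne']
  refine div_le_div_of_nonneg_right (Real.log_le_log ?_ ?_) (Real.log_natCast_nonneg _)
  · exact Finset.prod_pos fun j _ => F.relIndex_pos (P j) i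
  · exact_mod_cast h

theorem logIndexRatio_le_add_sum {ι : Type*} {t : Finset ι} {P : ι → Subgroup Γ} {H : Subgroup Γ}
    {C i : ℕ} (h : (F.seq i).relIndex H ≤ C * ∏ j ∈ t, (F.seq i).relIndex (P j)) :
    F.logIndexRatio H i ≤
      Real.log C / Real.log (F.seq i).index + ∑ j ∈ t, F.logIndexRatio (P j) i := by
  have hP : ∀ j ∈ t, ((F.seq i).relIndex (P j) : ℝ) ≠ 0 := fun j _ => (F.relIndex_pos (P j) i).ne'
  have hC : (C : ℝ) ≠ 0 := by
    rintro hC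
    rw [Nat.cast_eq_zero.1 hC, zero_mul, Nat.le_zero] at h
    exact F.relIndex_ne_zero i H h
  simp only [logIndexRatio]
  rw [← Finset.sum_div, ← Real.log_prod hP, ← add_div,
    ← Real.log_mul hC (Finset.prod_ne_zero_iff.2 hP)]
  refine div_le_div_of_nonneg_right (Real.log_le_log (F.relIndex_pos H i) ?_)
    (Real.log_natCast_nonneg _)
  exact_mod_cast h

theorem logIndexRatio_le_add {H K : Subgroup Γ} {C i : ℕ}
    (h : (F.seq i).relIndex H ≤ C * (F.seq i).relIndex K) :
    F.logIndexRatio H i ≤ Real.log C / Real.log (F.seq i).index + F.logIndexRatio K i := by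
  simpa using F.logIndexRatio_le_add_sum (t := {()}) (P := fun _ => K) (by simpa using h)

theorem tendsto_logIndexRatio_of_relIndex_le_mul {H K : Subgroup Γ} {α : ℝ} {C : ℕ → ℕ}
    (hH : Tendsto (F.logIndexRatio H) atTop (𝓝 α)) (hKH : K ≤ H)
    (hC : Tendsto (fun i => Real.log (C i) / Real.log (F.seq i).index) atTop (𝓝 0))
    (h : ∀ i, (F.seq i).relIndex H ≤ C i * (F.seq i).relIndex K) :
    Tendsto (F.logIndexRatio K) atTop (𝓝 α) := by
  refine tendsto_of_tendsto_of_tendsto_of_le_of_le (by simpa using hH.sub hC) hH (fun i => ?_)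
    fun i => F.logIndexRatio_mono hKH i
  exact sub_le_iff_le_add'.2 (F.logIndexRatio_le_add (h i))

end LogIndexRatio

theorem hspecBounded_mono {Γ : Type*} [Group Γ] [TopologicalSpace Γ] (F : FiltrationSeries Γ)
    {b c : ℕ} (h : b ≤ c) : F.hspecBounded b ⊆ F.hspecBounded c := by
  rintro _ ⟨H, hH, ⟨S, hS, hSH⟩, rfl⟩
  exact ⟨H, hH, ⟨S, hS.trans h, hSH⟩, rfl⟩

theorem hspec_eq_Icc_of_subset [Infinite Γ] (F : FiltrationSeries Γ) {b : ℕ}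
    (h : Set.Icc 0 1 ⊆ F.hspecBounded b) :
    F.hspecBounded b = Set.Icc 0 1 ∧ F.hspecFG = Set.Icc 0 1 ∧ F.hspec = Set.Icc 0 1 := by
  have hfg : F.hspecBounded b ⊆ F.hspecFG := fun _ ⟨H, hH, ⟨S, _, hS⟩, hd⟩ => ⟨H, hH, ⟨S, hS⟩, hd⟩
  have hall : F.hspecFG ⊆ F.hspec := fun _ ⟨H, hH, _, hd⟩ => ⟨H, hH, trivial, hd⟩
  have hle : F.hspec ⊆ Set.Icc 0 1 := by
    rintro _ ⟨H, -, -, rfl⟩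
    exact ⟨zero_le, F.hdim_le_one H⟩
  exact ⟨(hfg.trans (hall.trans hle)).antisymm h, (hall.trans hle).antisymm (h.trans hfg),
    hle.antisymm (h.trans (hfg.trans hall))⟩

end FiltrationSeries

end HausdorffDimension

/-! ### Indices of commuting families and of commutator subgroups -/

section RelIndex

variable {A : Type*} [Group A]

theorem relIndex_eq_card_map_mk (N : Subgroup A) [N.Normal] (H : Subgroup A) :
    N.relIndex H = Nat.card (H.map (QuotientGroup.mk' N)) := by
  rw [← Subgroup.relIndex_ker, QuotientGroup.ker_mk']

theorem relIndex_le_relIndex_mul_relIndex_inf {N U H : Subgroup A} [N.FiniteIndex]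
    (hU : U.relIndex H ≠ 0) : N.relIndex H ≤ U.relIndex H * N.relIndex (U ⊓ H) := by
  rw [mul_comm, Subgroup.relIndex_inf_mul_relIndex]
  refine Subgroup.relIndex_le_of_le_left inf_le_left (Subgroup.relIndex_inf_ne_zero ?_ hU)
  exact mt Subgroup.index_eq_zero_of_relIndex_eq_zero N.index_ne_zero_of_finite

theorem index_le_relIndex_commutator_mul_pow_rank [Group.FG A] (N : Subgroup A) [N.Normal] {e : ℕ}
    (he : 0 < e) (h : ∀ a : A, a ^ e ∈ N) :
    N.index ≤ N.relIndex (commutator A) * e ^ Group.rank A := by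
  let M : Subgroup A := commutator A ⊔ N
  let _ : CommGroup (A ⧸ M) :=
    { (inferInstance : Group (A ⧸ M)) with
      mul_comm :=
        (Subgroup.Normal.quotient_commutative_iff_commutator_le.2 le_sup_left).is_comm.comm }
  have hcard : M.index ∣ e ^ Group.rank (A ⧸ M) := card_dvd_exponent_pow_rank' (A ⧸ M) fun x => by
    obtain ⟨a, rfl⟩ := QuotientGroup.mk_surjective x
    exact (QuotientGroup.eq_one_iff (N := M) _).2 (le_sup_right (a := commutator A) (h a))
  have hrank : Group.rank (A ⧸ M) ≤ Group.rank A :=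
    Group.rank_le_of_surjective (QuotientGroup.mk' M) (QuotientGroup.mk'_surjective M)
  calc N.index = N.relIndex (commutator A) * M.index := by
        rw [← Subgroup.relIndex_sup_right, Subgroup.relIndex_mul_index le_sup_right]
    _ ≤ N.relIndex (commutator A) * e ^ Group.rank A :=
        Nat.mul_le_mul_left _
          ((Nat.le_of_dvd (pow_pos he _) hcard).trans (Nat.pow_le_pow_right he hrank))

end RelIndex

section CommutingFamily

variable {A ι : Type*} [Group A] {N : Subgroup A} [N.Normal] {R : ι → Subgroup A}

theorem commute_map_mk (hcomm : Pairwise fun i j => ∀ x y : A, x ∈ R i → y ∈ R j → Commute x y) :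
    Pairwise fun i j => ∀ x y : A ⧸ N, x ∈ (R i).map (QuotientGroup.mk' N) →
      y ∈ (R j).map (QuotientGroup.mk' N) → Commute x y := by
  rintro i j hij _ _ ⟨x, hx, rfl⟩ ⟨y, hy, rfl⟩
  exact (hcomm hij x y hx hy).map _

variable {Q : Type*} [Group Q] [Fintype ι] {P : ι → Subgroup Q}

theorem iSupIndep_of_injective_noncommPiCoprod
    (hcomm : Pairwise fun i j => ∀ x y : Q, x ∈ P i → y ∈ P j → Commute x y)
    (hinj : Function.Injective (Subgroup.noncommPiCoprod hcomm)) : iSupIndep P := by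
  classical
  intro i
  rw [disjoint_iff_inf_le]
  rintro x ⟨hxi, hx⟩
  have hle : (⨆ (j) (_ : j ≠ i), P j) ≤
      (Pi.evalMonoidHom (fun j => P j) i).ker.map (Subgroup.noncommPiCoprod hcomm) :=
    iSup₂_le fun j hj y hy => ⟨Pi.mulSingle j ⟨y, hy⟩, Pi.mulSingle_eq_of_ne hj.symm _,
      Subgroup.noncommPiCoprod_mulSingle j _⟩
  obtain ⟨f, hf, hfx⟩ := hle hx
  have hfi : f = Pi.mulSingle i (⟨x, hxi⟩ : P i) :=
    hinj (hfx.trans (Subgroup.noncommPiCoprod_mulSingle i (⟨x, hxi⟩ : P i)).symm)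
  have hone : f i = 1 := hf
  rw [hfi, Pi.mulSingle_eq_same] at hone
  exact congrArg Subtype.val hone

theorem card_iSup_le_prod [Finite Q]
    (hcomm : Pairwise fun i j => ∀ x y : Q, x ∈ P i → y ∈ P j → Commute x y) :
    Nat.card (⨆ i, P i : Subgroup Q) ≤ ∏ i, Nat.card (P i) := by
  rw [← Subgroup.noncommPiCoprod_range (hcomm := hcomm), ← Nat.card_pi]
  exact Nat.card_le_card_of_surjective _ (MonoidHom.rangeRestrict_surjective _)

theorem card_iSup_eq_prod
    (hcomm : Pairwise fun i j => ∀ x y : Q, x ∈ P i → y ∈ P j → Commute x y)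
    (hind : iSupIndep P) : Nat.card (⨆ i, P i : Subgroup Q) = ∏ i, Nat.card (P i) := by
  rw [← Subgroup.noncommPiCoprod_range (hcomm := hcomm), ← Nat.card_pi]
  exact (Nat.card_congr (MonoidHom.ofInjective
    (Subgroup.injective_noncommPiCoprod_of_iSupIndep (hcomm := hcomm) hind)).toEquiv).symm

theorem iSupIndep_of_card_iSup_eq_prod [Finite Q]
    (hcomm : Pairwise fun i j => ∀ x y : Q, x ∈ P i → y ∈ P j → Commute x y)
    (hcard : Nat.card (⨆ i, P i : Subgroup Q) = ∏ i, Nat.card (P i)) : iSupIndep P := by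
  refine iSupIndep_of_injective_noncommPiCoprod hcomm ?_
  rw [← MonoidHom.rangeRestrict_injective_iff]
  refine ((Nat.bijective_iff_surjective_and_card _).2
    ⟨MonoidHom.rangeRestrict_surjective _, ?_⟩).1
  rw [Nat.card_pi, Subgroup.noncommPiCoprod_range, hcard]

theorem relIndex_iSup_le_prod [N.FiniteIndex]
    (hcomm : Pairwise fun i j => ∀ x y : A, x ∈ R i → y ∈ R j → Commute x y) :
    N.relIndex (⨆ i, R i) ≤ ∏ i, N.relIndex (R i) := by
  simp only [relIndex_eq_card_map_mk, Subgroup.map_iSup]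
  exact card_iSup_le_prod (commute_map_mk hcomm)

theorem relIndex_iSup_eq_prod
    (hcomm : Pairwise fun i j => ∀ x y : A, x ∈ R i → y ∈ R j → Commute x y)
    (hind : iSupIndep fun i => (R i).map (QuotientGroup.mk' N)) :
    N.relIndex (⨆ i, R i) = ∏ i, N.relIndex (R i) := by
  simp only [relIndex_eq_card_map_mk, Subgroup.map_iSup]
  exact card_iSup_eq_prod (commute_map_mk hcomm) hind

end CommutingFamily

/-! ### Regular branch groups and their closures -/

/-- The largest subgroup of `K ⊓ G` that is normalized by `G`, as a subgroup of the ambient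
group. -/
def relNormalCore {A : Type*} [Group A] (K G : Subgroup A) : Subgroup A :=
  (K.subgroupOf G).normalCore.map G.subtype

section RelNormalCore

variable {A : Type*} [Group A] {K G : Subgroup A}

theorem mem_relNormalCore_iff {k : A} :
    k ∈ relNormalCore K G ↔ k ∈ G ∧ ∀ g ∈ G, g * k * g⁻¹ ∈ K :=
  ⟨fun ⟨k, hk, e⟩ => e ▸ ⟨k.2, fun g hg => hk ⟨g, hg⟩⟩,
    fun ⟨hk, h⟩ => ⟨⟨k, hk⟩, fun g => h g.1 g.2, rfl⟩⟩

theorem conj_mem_relNormalCore {g k : A} (hg : g ∈ G) (hk : k ∈ relNormalCore K G) :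
    g * k * g⁻¹ ∈ relNormalCore K G := by
  rw [mem_relNormalCore_iff] at hk ⊢
  refine ⟨mul_mem (mul_mem hg hk.1) (inv_mem hg), fun h hh => ?_⟩
  simpa [mul_assoc] using hk.2 (h * g) (mul_mem hh hg)

theorem relIndex_relNormalCore_ne_zero [(K.subgroupOf G).FiniteIndex] :
    (relNormalCore K G).relIndex G ≠ 0 := by
  rw [Subgroup.relIndex, Subgroup.subgroupOf, relNormalCore,
    Subgroup.comap_map_eq_self_of_injective G.subtype_injective]
  exact Subgroup.FiniteIndex.index_ne_zero

end RelNormalCore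

namespace TreeAut

variable {m : ℕ}

theorem graft_mulSingle {V : Set (Vertex m)} (hV : PrefixFree V) {v : Vertex m} (hv : v ∈ V)
    (g : TreeAut m) : graft hV (Pi.mulSingle v g) = place v g := by
  refine ext_apply fun u => ?_
  by_cases hvu : v <+: u
  · obtain ⟨z, rfl⟩ := hvu
    rw [graft_apply_append hV _ hv, Pi.mulSingle_eq_same, place_apply_append]
  · rw [place_apply_of_not _ hvu]
    by_cases hu : ∃ w ∈ V, w <+: u
    · obtain ⟨w, hw, z, rfl⟩ := hu
      have hwv : w ≠ v := fun h => hvu (h ▸ List.prefix_append w z)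
      rw [graft_apply_append hV _ hw, Pi.mulSingle_eq_of_ne hwv, one_apply]
    · exact graft_apply_of_not hV _ hu

theorem graft_mem_of_finite {L : Subgroup (TreeAut m)} {V : Set (Vertex m)} (hV : PrefixFree V)
    (hfin : V.Finite) {s : Vertex m → TreeAut m} (h : ∀ v ∈ V, place v (s v) ∈ L) :
    graft hV s ∈ L := by
  suffices key : graft hV (V.mulIndicator s) ∈ L by
    rwa [graft_congr hV fun v hv => (Set.mulIndicator_of_mem hv s).symm]
  refine hfin.induction_on_subset V (motive := fun W _ => graft hV (W.mulIndicator s) ∈ L) ?_ ?_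
  · rw [Set.mulIndicator_empty', map_one]
    exact one_mem L
  · intro v W hv _ hvW ih
    rw [Set.insert_eq, Set.mulIndicator_union_of_disjoint (Set.disjoint_singleton_left.2 hvW)]
    change graft hV (Set.mulIndicator {v} s * Set.mulIndicator W s) ∈ L
    rw [map_mul, Set.mulIndicator_singleton, graft_mulSingle hV hv]
    exact mul_mem (h v hv) ih

/-- The group `G` is self-similar and level-transitive, and `K` is a normal subgroup of finite index
that contains its own copies at all vertices. -/
structure IsNormalBranch (G K : Subgroup (TreeAut m)) : Prop where
  sec_mem : ∀ g ∈ G, ∀ v, sec g v ∈ G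
  transitive : IsLevelTransitive G
  le : K ≤ G
  relIndex_ne_zero : K.relIndex G ≠ 0
  conj_mem : ∀ g ∈ G, ∀ k ∈ K, g * k * g⁻¹ ∈ K
  place_mem : ∀ w, ∀ k ∈ K, place w k ∈ K

theorem IsBranching.place_singleton_mem {K : Subgroup (TreeAut m)} (hK : IsBranching K) (x : Fin m)
    {k : TreeAut m} (hk : k ∈ K) : place [x] k ∈ K := by
  obtain ⟨g, ⟨hgK, hg1⟩, hg⟩ := hK (Pi.mulSingle x k) fun y => by
    obtain rfl | hyx := eq_or_ne y x
    · rwa [Pi.mulSingle_eq_same]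
    · rw [Pi.mulSingle_eq_of_ne hyx]
      exact one_mem K
  suffices place [x] k = g by rwa [this]
  refine ext_apply fun u => ?_
  rcases u with _ | ⟨y, u⟩
  · rw [g.2.1, (place [x] k).2.1]
  have hgy : g.1 (y :: u) = y :: ((Pi.mulSingle x k : Fin m → TreeAut m) y).1 u := by
    simpa [hg1 [y] rfl] using hg y u
  obtain rfl | hyx := eq_or_ne y x
  · rw [hgy, Pi.mulSingle_eq_same]
    exact place_apply_append [y] k u
  · rw [hgy, Pi.mulSingle_eq_of_ne hyx, one_apply, place_apply_of_not _ (by simpa using hyx.symm)]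

theorem place_singleton_mem_relNormalCore {G K : Subgroup (TreeAut m)}
    (hsec : ∀ g ∈ G, ∀ v, sec g v ∈ G) (hKG : K ≤ G) (hK : IsBranching K) (x : Fin m)
    {k : TreeAut m} (hk : k ∈ relNormalCore K G) : place [x] k ∈ relNormalCore K G := by
  have hconj : ∀ g ∈ G, g * place [x] k * g⁻¹ ∈ K := by
    intro g hg
    obtain ⟨y, hy⟩ := List.length_eq_one_iff.1 ((length_apply g [x]).trans rfl)
    rw [conj_place, hy]
    exact hK.place_singleton_mem y ((mem_relNormalCore_iff.1 hk).2 _ (hsec g hg [x]))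
  exact mem_relNormalCore_iff.2 ⟨hKG (by simpa using hconj 1 (one_mem G)), hconj⟩

theorem IsRegularBranch.exists_isNormalBranch {G : Subgroup (TreeAut m)} (hG : IsRegularBranch G) :
    ∃ K, IsNormalBranch G K := by
  obtain ⟨hself, htrans, K, hKG, _, hK⟩ := hG
  have hsec : ∀ g ∈ G, ∀ v, sec g v ∈ G := fun g hg v =>
    let ⟨h, hh, hs⟩ := hself g hg v
    hs.eq_sec ▸ hh
  have hplace : ∀ w, ∀ k ∈ relNormalCore K G, place w k ∈ relNormalCore K G := by
    intro w k hk
    induction w with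
    | nil => rwa [show place [] k = k from ext_apply fun u => place_apply_append [] k u]
    | cons x w ih =>
      rw [← List.singleton_append, place_append]
      exact place_singleton_mem_relNormalCore hsec hKG hK x ih
  exact ⟨relNormalCore K G, hsec, htrans, fun k hk => (mem_relNormalCore_iff.1 hk).1,
    relIndex_relNormalCore_ne_zero, fun g hg k hk => conj_mem_relNormalCore hg hk, hplace⟩

theorem sec_mem_topologicalClosure {G : Subgroup (TreeAut m)} (hG : ∀ g ∈ G, ∀ v, sec g v ∈ G)
    {g : TreeAut m} (hg : g ∈ G.topologicalClosure) (v : Vertex m) :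
    sec g v ∈ G.topologicalClosure := by
  rw [mem_topologicalClosure_iff]
  intro n
  obtain ⟨h, hh, hgh⟩ := mem_topologicalClosure_iff.1 hg (v.length + n)
  refine ⟨sec h v, hG h hh v, fun u hu => ?_⟩
  have hvu := hgh (v ++ u) (by rw [List.length_append, hu])
  rw [apply_append, apply_append, apply_eq_of_le hgh (Nat.le_add_right _ _)] at hvu
  exact List.append_cancel_left hvu

namespace IsNormalBranch

variable {G K : Subgroup (TreeAut m)}

theorem closure_le (hK : IsNormalBranch G K) : K.topologicalClosure ≤ G.topologicalClosure :=
  Subgroup.topologicalClosure_mono hK.le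

theorem place_mem_closure (hK : IsNormalBranch G K) (w : Vertex m) {k : TreeAut m}
    (hk : k ∈ K.topologicalClosure) : place w k ∈ K.topologicalClosure :=
  map_mem_closure (continuous_place w) hk fun k hk => hK.place_mem w k hk

theorem graft_mem_closure (hK : IsNormalBranch G K) {V : Set (Vertex m)} (hV : PrefixFree V)
    {s : Vertex m → TreeAut m} (hs : ∀ v ∈ V, s v ∈ K) : graft hV s ∈ K.topologicalClosure := by
  rw [mem_topologicalClosure_iff]
  intro n
  let W : Set (Vertex m) := V ∩ {v | v.length ≤ n}
  have hW : PrefixFree W := hV.mono Set.inter_subset_left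
  have hfin : W.Finite := (List.finite_length_le (Fin m) n).subset Set.inter_subset_right
  refine ⟨graft hW s, graft_mem_of_finite hW hfin fun w hw => hK.place_mem w _ (hs w hw.1),
    fun u hu => ?_⟩
  by_cases h : ∃ v ∈ V, v <+: u
  · obtain ⟨v, hv, hvu⟩ := h
    have hvW : v ∈ W := ⟨hv, hvu.length_le.trans_eq hu⟩
    obtain ⟨z, rfl⟩ := hvu
    rw [graft_apply_append hV s hv, graft_apply_append hW s hvW]
  · rw [graft_apply_of_not hV s h, graft_apply_of_not hW s fun ⟨v, hv, hvu⟩ => h ⟨v, hv.1, hvu⟩]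

theorem exists_levelStab_le (hK : IsNormalBranch G K) :
    ∃ N, ∀ g ∈ G.topologicalClosure, g ∈ levelStab m N → g ∈ K.topologicalClosure := by
  have hfin : (K.topologicalClosure.subgroupOf G.topologicalClosure).FiniteIndex :=
    ⟨relIndex_topologicalClosure_ne_zero hK.relIndex_ne_zero⟩
  have hopen := Subgroup.isOpen_of_isClosed_of_finiteIndex
    (K.topologicalClosure.subgroupOf G.topologicalClosure)
    (K.isClosed_topologicalClosure.preimage continuous_subtype_val)
  obtain ⟨U, hU, hUK⟩ := isOpen_induced_iff.1 hopen
  have hmem : ∀ g ∈ G.topologicalClosure, g ∈ U ↔ g ∈ K.topologicalClosure :=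
    fun g hg => Set.ext_iff.1 hUK ⟨g, hg⟩
  obtain ⟨N, hN⟩ := hU 1 ((hmem 1 (one_mem _)).2 (one_mem _))
  exact ⟨N, fun g hg hgN => (hmem g hg).1 (hN g (by simpa using hgN))⟩

theorem exists_place_sec_mem_closure (hK : IsNormalBranch G K) (k : ℕ) :
    ∃ N, k ≤ N ∧ ∀ g ∈ G.topologicalClosure, g ∈ levelStab m N → ∀ w : Vertex m, w.length = k →
      place w (sec g w) ∈ G.topologicalClosure := by
  obtain ⟨N, hN⟩ := hK.exists_levelStab_le
  refine ⟨k + N, Nat.le_add_right k N, fun g hg hgN w hw => hK.closure_le ?_⟩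
  exact hK.place_mem_closure w
    (hN _ (sec_mem_topologicalClosure hK.sec_mem hg w) (sec_mem_levelStab hgN hw))

end IsNormalBranch

end TreeAut

/-! ### Rigid stabilizers in a filtration -/

namespace TreeAut

variable {m : ℕ}

instance (Γ : Subgroup (TreeAut m)) : CompactSpace Γ.topologicalClosure :=
  isCompact_iff_compactSpace.1 Γ.isClosed_topologicalClosure.isCompact

/-- The `k`-th level of the tree. -/
abbrev Level (m k : ℕ) : Type := {v : Vertex m // v.length = k}

instance (k : ℕ) : Fintype (Level m k) :=
  inferInstanceAs (Fintype (List.Vector (Fin m) k))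

theorem card_level (k : ℕ) : Fintype.card (Level m k) = m ^ k :=
  (card_vector (α := Fin m) k).trans (by rw [Fintype.card_fin])

/-- The subgroup of the elements of `Γ` that fix every vertex of the subtree rooted at `w`. -/
def coneFixer (Γ : Subgroup (TreeAut m)) (w : Vertex m) : Subgroup Γ where
  carrier := {g | ∀ u, g.1.1 (w ++ u) = w ++ u}
  one_mem' := fun _ => rfl
  mul_mem' := by
    intro g h hg hh u
    change g.1.1 (h.1.1 (w ++ u)) = w ++ u
    rw [hh u, hg u]
  inv_mem' := by
    intro g hg u
    change g.1.1⁻¹ (w ++ u) = w ++ u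
    rw [Equiv.Perm.inv_eq_iff_eq, hg u]

section Rist

variable {Γ : Subgroup (TreeAut m)} {k : ℕ}

theorem not_prefix_of_level_ne {v w : Level m k} (h : v ≠ w) : ¬ v.1 <+: w.1 := fun hvw =>
  h (Subtype.ext (hvw.eq_of_length (v.2.trans w.2.symm)))

theorem rist_commute {v w : Level m k} (hvw : v ≠ w) {x y : Γ} (hx : x ∈ rist Γ v.1)
    (hy : y ∈ rist Γ w.1) : Commute x y :=
  Subtype.ext (SupportedAt.commute (g := x.1) (h := y.1) hx hy (not_prefix_of_level_ne hvw)
    (not_prefix_of_level_ne hvw.symm))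

theorem rist_le_coneFixer {v w : Level m k} (hvw : v ≠ w) : rist Γ v.1 ≤ coneFixer Γ w.1 :=
  fun _ hg u => hg.2 _ fun hv => (List.prefix_or_prefix_of_prefix hv (w.1.prefix_append u)).elim
    (not_prefix_of_level_ne hvw) (not_prefix_of_level_ne hvw.symm)

open scoped Pointwise in
theorem conj_smul_rist (g : Γ) (v : Vertex m) :
    MulAut.conj g • rist Γ v = rist Γ (g.1.1 v) := by
  have hle : ∀ (g : Γ) (v : Vertex m), MulAut.conj g • rist Γ v ≤ rist Γ (g.1.1 v) := by
    rintro g v _ ⟨x, hx, rfl⟩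
    exact SupportedAt.conj (g := x.1) hx g.1
  refine le_antisymm (hle g v) ?_
  have hinv := hle g⁻¹ (g.1.1 v)
  rw [show (g⁻¹ : Γ).1.1 (g.1.1 v) = v from inv_apply_self g.1 v, map_inv] at hinv
  rwa [← Subgroup.pointwise_smul_le_pointwise_smul_iff (a := MulAut.conj g), smul_inv_smul] at hinv

theorem relIndex_rist_eq (F : FiltrationSeries Γ) (htrans : IsLevelTransitive Γ) {v w : Vertex m}
    (h : v.length = w.length) (i : ℕ) :
    (F.seq i).relIndex (rist Γ v) = (F.seq i).relIndex (rist Γ w) := by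
  obtain ⟨g, hg, rfl⟩ := htrans v w h
  rw [← conj_smul_rist ⟨g, hg⟩ v]
  nth_rw 2 [← Subgroup.Normal.conj_smul_eq_self (⟨g, hg⟩ : Γ) (F.seq i)]
  rw [Subgroup.relIndex_pointwise_smul]

/-- For almost all `i`, the images in `Γ ⧸ Γ_i` of the rigid stabilizers of the vertices of any
fixed level are independent. This is how niceness of a filtration is used. -/
def HasIndependentRists (F : FiltrationSeries Γ) : Prop :=
  ∀ k : ℕ, 1 ≤ k → ∀ᶠ i in Filter.atTop, iSupIndep fun v : Level m k =>
    (rist Γ v.1).map (QuotientGroup.mk' (F.seq i))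

theorem IsNice.hasIndependentRists [CompactSpace Γ] {F : FiltrationSeries Γ} (h : IsNice Γ F) :
    HasIndependentRists F := by
  intro k hk
  filter_upwards [h k hk] with i ⟨e⟩
  refine iSupIndep_of_card_iSup_eq_prod
    (commute_map_mk fun v w hvw x y => rist_commute (x := x) (y := y) hvw) ?_
  rw [← Nat.card_pi, ← Nat.card_congr e.toEquiv, levelRist, Subgroup.map_iSup]

theorem mem_levelStab_of_supportedAt {w : Vertex m} {a b : TreeAut m} {n : ℕ}
    (ha : SupportedAt w a) (hb : ∀ u, b.1 (w ++ u) = w ++ u) (hab : b⁻¹ * a ∈ levelStab m n) :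
    a ∈ levelStab m n := by
  intro u hu
  by_cases hwu : w <+: u
  · rw [inv_mul_mem_levelStab_iff.1 hab u hu]
    obtain ⟨u, rfl⟩ := hwu
    exact hb u
  · exact ha.2 u hwu

theorem hasIndependentRists_levelStabFiltration (Γ : Subgroup (TreeAut m)) :
    HasIndependentRists (levelStabFiltration Γ) := by
  refine fun k _ => Filter.Eventually.of_forall fun n v => ?_
  rw [disjoint_iff_inf_le]
  rintro _ ⟨⟨a, ha, rfl⟩, hb⟩
  simp only [← Subgroup.map_iSup] at hb
  obtain ⟨b, hb, hab⟩ := hb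
  have hfix : b ∈ coneFixer Γ v.1 :=
    (iSup₂_le fun w hw => rist_le_coneFixer hw : ⨆ (w) (_ : w ≠ v), rist Γ w.1 ≤ _) hb
  have hba : b⁻¹ * a ∈ (levelStabFiltration Γ).seq n := QuotientGroup.eq.1 hab
  exact (QuotientGroup.eq_one_iff a).2 (mem_levelStab_of_supportedAt (b := b.1) ha hfix hba)

theorem relIndex_iSup_eq_prod_of_le_rist {F : FiltrationSeries Γ} {i : ℕ}
    (hind : iSupIndep fun v : Level m k => (rist Γ v.1).map (QuotientGroup.mk' (F.seq i)))
    (B : Finset (Level m k)) {P : Level m k → Subgroup Γ} (hP : ∀ v ∈ B, P v ≤ rist Γ v.1) :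
    (F.seq i).relIndex (⨆ v : B, P v) = ∏ v ∈ B, (F.seq i).relIndex (P v) := by
  rw [← Finset.prod_coe_sort]
  refine relIndex_iSup_eq_prod (fun v w hvw x y hx hy => ?_) ?_
  · exact rist_commute (Subtype.coe_ne_coe.2 hvw) (hP v v.2 hx) (hP w w.2 hy)
  · exact (hind.comp Subtype.val_injective).mono fun v => Subgroup.map_mono (hP v v.2)

theorem relIndex_iSup_rist_le_prod [CompactSpace Γ] (F : FiltrationSeries Γ) (i : ℕ)
    (A : Finset (Level m k)) :
    (F.seq i).relIndex (⨆ v : A, rist Γ v.1.1) ≤ ∏ v ∈ A, (F.seq i).relIndex (rist Γ v.1) := by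
  rw [← Finset.prod_coe_sort]
  exact relIndex_iSup_le_prod fun v w hvw x y => rist_commute (Subtype.coe_ne_coe.2 hvw)

end Rist

theorem eq_graft_sec {k : ℕ} {g : TreeAut m} (hg : g ∈ levelStab m k) {A : Finset (Level m k)}
    (hA : PrefixFree ((↑) '' (A : Set (Level m k)) : Set (Vertex m)))
    (hfix : ∀ v ∉ A, ∀ u, g.1 (v.1 ++ u) = v.1 ++ u) : g = graft hA (sec g) := by
  refine ext_apply fun u => ?_
  by_cases h : ∃ v ∈ ((↑) '' (A : Set (Level m k)) : Set (Vertex m)), v <+: u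
  · obtain ⟨v, hv, z, rfl⟩ := h
    rw [graft_apply_append hA _ hv, apply_append]
    obtain ⟨v, -, rfl⟩ := hv
    rw [hg v v.2]
  · rw [graft_apply_of_not hA _ h]
    rcases le_total u.length k with hu | hu
    · exact levelStab_antitone hu hg u rfl
    · let v : Level m k := ⟨u.take k, by simp [hu]⟩
      have hv : v ∉ A := fun hv => h ⟨v, ⟨v, hv, rfl⟩, List.take_prefix k u⟩
      simpa only [v, List.take_append_drop] using hfix v hv (u.drop k)

namespace IsNormalBranch

variable {G K : Subgroup (TreeAut m)}

theorem transitive_closure (hK : IsNormalBranch G K) : IsLevelTransitive G.topologicalClosure :=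
  fun u v huv =>
    let ⟨g, hg, hgu⟩ := hK.transitive u v huv
    ⟨g, G.le_topologicalClosure hg, hgu⟩

theorem exists_finiteIndex_inf_le_iSup_rist (hK : IsNormalBranch G K) (k : ℕ) :
    ∃ U : Subgroup G.topologicalClosure, U.FiniteIndex ∧
      ∀ (A : Finset (Level m k)) (H : Subgroup G.topologicalClosure),
        (∀ v ∉ A, H ≤ coneFixer G.topologicalClosure v.1) →
        U ⊓ H ≤ ⨆ v : A, rist G.topologicalClosure v.1.1 := by
  obtain ⟨N, hkN, hN⟩ := hK.exists_place_sec_mem_closure k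
  refine ⟨(levelStabFiltration G.topologicalClosure).seq N, inferInstance, fun A H hfix g hg => ?_⟩
  have hA : PrefixFree ((↑) '' (A : Set (Level m k)) : Set (Vertex m)) :=
    prefixFree_of_length (k := k) (by rintro _ ⟨v, -, rfl⟩; exact v.2)
  have hgraft : g.1 = graft hA (sec g.1) :=
    eq_graft_sec (levelStab_antitone hkN hg.1) hA fun v hv => hfix v hv hg.2
  have hmem : graft hA (sec g.1) ∈
      (⨆ v : A, rist G.topologicalClosure v.1.1).map G.topologicalClosure.subtype := by
    refine graft_mem_of_finite hA (A.finite_toSet.image _) ?_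
    rintro _ ⟨v, hv, rfl⟩
    refine ⟨⟨_, hN g.1 g.2 hg.1 v v.2⟩, ?_, rfl⟩
    exact le_iSup (fun v : A => rist G.topologicalClosure v.1.1) ⟨v, hv⟩ (supportedAt_place v.1 _)
  rw [← hgraft] at hmem
  exact (Subgroup.mem_map_iff_mem Subtype.val_injective).1 hmem

theorem exists_relIndex_le_mul_prod_rist (hK : IsNormalBranch G K) (k : ℕ) :
    ∃ C : ℕ, ∀ (F : FiltrationSeries G.topologicalClosure) (A : Finset (Level m k))
      (H : Subgroup G.topologicalClosure),
      (∀ v ∉ A, H ≤ coneFixer G.topologicalClosure v.1) →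
      ∀ i, (F.seq i).relIndex H ≤
        C * ∏ v ∈ A, (F.seq i).relIndex (rist G.topologicalClosure v.1) := by
  obtain ⟨U, _, hU⟩ := hK.exists_finiteIndex_inf_le_iSup_rist k
  have htop : U.relIndex ⊤ ≠ 0 := by
    rw [Subgroup.relIndex_top_right]
    exact U.index_ne_zero_of_finite
  have hU₀ : ∀ H, U.relIndex H ≠ 0 := fun H =>
    mt (Subgroup.relIndex_eq_zero_of_le_right le_top) htop
  refine ⟨U.relIndex ⊤, fun F A H hfix i => ?_⟩
  calc (F.seq i).relIndex H ≤ U.relIndex H * (F.seq i).relIndex (U ⊓ H) :=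
        relIndex_le_relIndex_mul_relIndex_inf (hU₀ H)
    _ ≤ U.relIndex ⊤ * ∏ v ∈ A, (F.seq i).relIndex (rist G.topologicalClosure v.1) :=
        Nat.mul_le_mul (Subgroup.relIndex_le_of_le_right le_top htop)
          ((F.relIndex_mono (hU A H hfix) i).trans (relIndex_iSup_rist_le_prod F i A))

end IsNormalBranch

end TreeAut

/-! ### Orders of the images in finite quotients -/

section TopologicalClosure

theorem topologicalClosure_le_sup_of_isOpen {A : Type*} [Group A] [TopologicalSpace A]
    [IsTopologicalGroup A] (H : Subgroup A) {N : Subgroup A} (hN : IsOpen (N : Set A)) :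
    H.topologicalClosure ≤ H ⊔ N :=
  H.topologicalClosure_minimal le_sup_left
    (Subgroup.isClosed_of_isOpen _ (Subgroup.isOpen_mono le_sup_right hN))

theorem FiltrationSeries.relIndex_topologicalClosure {Γ : Type*} [Group Γ] [TopologicalSpace Γ]
    [IsTopologicalGroup Γ] [CompactSpace Γ] (F : FiltrationSeries Γ) (H : Subgroup Γ) (i : ℕ) :
    (F.seq i).relIndex H.topologicalClosure = (F.seq i).relIndex H := by
  refine le_antisymm ?_ (F.relIndex_mono H.le_topologicalClosure i)
  rw [← Subgroup.relIndex_sup_right H (F.seq i)]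
  exact F.relIndex_mono (topologicalClosure_le_sup_of_isOpen H (F.isOpen i)) i

end TopologicalClosure

namespace TreeAut

open scoped Nat

variable {m : ℕ}

instance (n : ℕ) : (levelStab m n).FiniteIndex :=
  have := Subgroup.quotient_finite_of_isOpen _ (isOpen_levelStab (m := m) n)
  Subgroup.finiteIndex_of_finite_quotient

theorem pow_le_relIndex_levelStab (hm : 0 < m) {G : Subgroup (TreeAut m)}
    (hG : IsLevelTransitive G) (n : ℕ) : m ^ n ≤ (levelStab m n).relIndex G := by
  let u : Vertex m := List.replicate n ⟨0, hm⟩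
  have hu : u.length = n := List.length_replicate
  choose g hg hgu using fun v : Level m n => hG u v.1 (hu.trans v.2.symm)
  rw [← card_level (m := m) n, ← Nat.card_eq_fintype_card]
  refine Nat.card_le_card_of_injective (β := G ⧸ (levelStab m n).subgroupOf G)
    (fun v => QuotientGroup.mk ⟨g v, hg v⟩) fun v w hvw => ?_
  have hmem := QuotientGroup.eq.1 hvw
  have happly : (g w).1 u = (g v).1 u := inv_mul_mem_levelStab_iff.1 hmem u hu
  rw [← Subtype.coe_inj, ← hgu v, ← hgu w, happly]

theorem IsLevelTransitive.infinite (hm : 2 ≤ m) {G : Subgroup (TreeAut m)}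
    (hG : IsLevelTransitive G) : Infinite G := by
  by_contra hfin
  rw [not_infinite_iff_finite] at hfin
  have hle : m ^ Nat.card G ≤ Nat.card G :=
    (pow_le_relIndex_levelStab (by omega) hG (Nat.card G)).trans
      (Nat.le_of_dvd Nat.card_pos (Subgroup.relIndex_dvd_card _ _))
  exact hle.not_gt (Nat.lt_pow_self (by omega))

theorem exists_perm_apply_concat {g : TreeAut m} {u : Vertex m} (hu : g.1 u = u) :
    ∃ σ : Equiv.Perm (Fin m), ∀ x, g.1 (u ++ [x]) = u ++ [σ x] := by
  choose f hf using (length_and_parent g u).2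
  rw [hu] at hf
  have hinj : Function.Injective f := fun a b hab => by
    simpa using g.1.injective (show g.1 (u ++ [a]) = g.1 (u ++ [b]) by rw [hf, hf, hab])
  exact ⟨Equiv.ofBijective f (Finite.injective_iff_bijective.1 hinj), hf⟩

theorem pow_apply_concat {g : TreeAut m} {u : Vertex m} {σ : Equiv.Perm (Fin m)}
    (hσ : ∀ x, g.1 (u ++ [x]) = u ++ [σ x]) (j : ℕ) (x : Fin m) :
    (g ^ j).1 (u ++ [x]) = u ++ [(σ ^ j) x] := by
  induction j with
  | zero => rfl
  | succ j ih => rw [pow_succ', mul_apply, ih, hσ, pow_succ', Equiv.Perm.mul_apply]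

theorem pow_factorial_mem_levelStab {g : TreeAut m} {n : ℕ} (hg : g ∈ levelStab m n) :
    g ^ m ! ∈ levelStab m (n + 1) := by
  intro v hv
  obtain ⟨u, x, rfl⟩ : ∃ u x, v = u ++ [x] :=
    ⟨v.dropLast, v.getLast (List.ne_nil_of_length_eq_add_one hv),
      (List.dropLast_append_getLast _).symm⟩
  obtain ⟨σ, hσ⟩ := exists_perm_apply_concat (hg u (by simpa using hv))
  have hone : σ ^ m ! = 1 := by
    simpa only [Fintype.card_perm, Fintype.card_fin] using pow_card_eq_one (x := σ)
  rw [pow_apply_concat hσ, hone, Equiv.Perm.one_apply]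

theorem levelStab_zero : levelStab m 0 = ⊤ :=
  eq_top_iff.2 fun g _ u hu => by rw [List.length_eq_zero_iff.1 hu]; exact g.2.1

theorem pow_factorial_pow_mem_levelStab (g : TreeAut m) (n : ℕ) :
    g ^ (m !) ^ n ∈ levelStab m n := by
  induction n with
  | zero => exact levelStab_zero (m := m) ▸ Subgroup.mem_top _
  | succ n ih =>
    rw [pow_succ, pow_mul]
    exact pow_factorial_mem_levelStab ih

theorem comap_place_levelStab (w : Vertex m) (n : ℕ) :
    (levelStab m (w.length + n)).comap (place w) = levelStab m n :=
  Subgroup.ext fun _ => place_mem_levelStab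

end TreeAut

/-! ### Asymptotic sizes of rigid stabilizers and of placed subgroups -/

namespace TreeAut

open Filter
open scoped Nat

variable {m : ℕ}

/-- The elements of `Γ` that act below the vertex `w` as an element of `L` and trivially elsewhere:
the copy of `L` at `w`, intersected with `Γ`. -/
noncomputable def placed (Γ L : Subgroup (TreeAut m)) (w : Vertex m) : Subgroup Γ :=
  (L.map (place w)).subgroupOf Γ

theorem placed_le_rist (Γ L : Subgroup (TreeAut m)) (w : Vertex m) : placed Γ L w ≤ rist Γ w := by
  rintro g ⟨k, -, hk⟩
  have hg : SupportedAt w g.1 := by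
    rw [← show place w k = g.1 from hk]
    exact supportedAt_place w k
  exact hg

/-- The copies of the commutator subgroup of `K` are asymptotically as large as the rigid
stabilizers that contain them. -/
def HasFullCommutators {Γ : Subgroup (TreeAut m)} (K : Subgroup (TreeAut m))
    (F : FiltrationSeries Γ) : Prop :=
  ∀ w : Vertex m, 1 ≤ w.length →
    Tendsto (F.logIndexRatio (placed Γ ⁅K, K⁆ w)) atTop (𝓝 ((m : ℝ) ^ w.length)⁻¹)

theorem sum_logIndexRatio_rist {Γ : Subgroup (TreeAut m)} (F : FiltrationSeries Γ)
    (hΓ : IsLevelTransitive Γ) (w : Vertex m) (A : Finset (Level m w.length)) (i : ℕ) :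
    ∑ v ∈ A, F.logIndexRatio (rist Γ v.1) i = A.card * F.logIndexRatio (rist Γ w) i := by
  rw [← nsmul_eq_mul]
  refine Finset.sum_eq_card_nsmul fun v _ => ?_
  simp only [FiltrationSeries.logIndexRatio, relIndex_rist_eq F hΓ v.2 i]

namespace IsNormalBranch

variable {G K : Subgroup (TreeAut m)}

theorem infinite_closure (hK : IsNormalBranch G K) (hm : 2 ≤ m) : Infinite G.topologicalClosure :=
  hK.transitive_closure.infinite hm

theorem tendsto_logIndexRatio_rist (hK : IsNormalBranch G K) (hm : 2 ≤ m)
    {F : FiltrationSeries G.topologicalClosure} (hF : HasIndependentRists F) {w : Vertex m}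
    (hw : 1 ≤ w.length) :
    Tendsto (F.logIndexRatio (rist G.topologicalClosure w)) atTop (𝓝 ((m : ℝ) ^ w.length)⁻¹) := by
  have := hK.infinite_closure hm
  have hmpos : (0 : ℝ) < (m : ℝ) ^ w.length := pow_pos (Nat.cast_pos.2 (by omega)) _
  have hsum (i : ℕ) : ∑ v : Level m w.length, F.logIndexRatio (rist G.topologicalClosure v.1) i =
      (m : ℝ) ^ w.length * F.logIndexRatio (rist G.topologicalClosure w) i := by
    rw [sum_logIndexRatio_rist F hK.transitive_closure w, Finset.card_univ, card_level,
      Nat.cast_pow]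
  obtain ⟨C, hC⟩ := hK.exists_relIndex_le_mul_prod_rist w.length
  have hlower (i : ℕ) : F.logIndexRatio ⊤ i - Real.log C / Real.log (F.seq i).index ≤
      (m : ℝ) ^ w.length * F.logIndexRatio (rist G.topologicalClosure w) i := by
    rw [sub_le_iff_le_add', ← hsum]
    exact F.logIndexRatio_le_add_sum
      (hC F Finset.univ ⊤ (fun v hv => absurd (Finset.mem_univ v) hv) i)
  have hupper : ∀ᶠ i in atTop,
      (m : ℝ) ^ w.length * F.logIndexRatio (rist G.topologicalClosure w) i ≤ 1 := by
    filter_upwards [hF w.length hw] with i hind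
    rw [← hsum]
    exact (F.sum_logIndexRatio_le (relIndex_iSup_eq_prod_of_le_rist hind Finset.univ
      fun v _ => le_rfl).ge).trans (F.logIndexRatio_le_one _ i)
  have hone : Tendsto
      (fun i => (m : ℝ) ^ w.length * F.logIndexRatio (rist G.topologicalClosure w) i)
      atTop (𝓝 1) := by
    refine tendsto_of_tendsto_of_tendsto_of_le_of_le' ?_ tendsto_const_nhds
      (Eventually.of_forall hlower) hupper
    simpa only [sub_zero] using
      F.tendsto_logIndexRatio_top.sub (F.tendsto_const_div_log_index (Real.log C))
  simpa only [inv_mul_cancel_left₀ hmpos.ne', mul_one] using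
    hone.const_mul ((m : ℝ) ^ w.length)⁻¹

theorem rist_le_placed_closure (hK : IsNormalBranch G K) (w : Vertex m) :
    rist G.topologicalClosure w ≤ placed G.topologicalClosure G.topologicalClosure w :=
  fun g hg => ⟨sec g.1 w, sec_mem_topologicalClosure hK.sec_mem g.2 w,
    (SupportedAt.eq_place (g := g.1) hg).symm⟩

theorem map_place_le (hK : IsNormalBranch G K) (w : Vertex m) {L : Subgroup (TreeAut m)}
    (hLK : L ≤ K) : L.map (place w) ≤ K := by
  rintro _ ⟨l, hl, rfl⟩
  exact hK.place_mem w l (hLK hl)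

theorem placed_closure_le (hK : IsNormalBranch G K) {L : Subgroup (TreeAut m)} (hLK : L ≤ K)
    (w : Vertex m) : placed G.topologicalClosure L.topologicalClosure w ≤
      (placed G.topologicalClosure L w).topologicalClosure := by
  rintro g ⟨l, hl, hlg⟩
  change g ∈ closure (placed G.topologicalClosure L w : Set G.topologicalClosure)
  rw [closure_subtype, ← show place w l = g.1 from hlg]
  refine map_mem_closure (continuous_place w) hl fun l' hl' => ?_
  have hmem : place w l' ∈ L.map (place w) := ⟨l', hl', rfl⟩
  exact ⟨⟨_, G.le_topologicalClosure (hK.le (hK.map_place_le w hLK hmem))⟩, hmem, rfl⟩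

theorem relIndex_placed_rist_ne_zero (hK : IsNormalBranch G K) {L : Subgroup (TreeAut m)}
    (hL : L.relIndex G ≠ 0) (w : Vertex m) :
    (placed G.topologicalClosure L.topologicalClosure w).relIndex
      (rist G.topologicalClosure w) ≠ 0 := by
  refine mt (Subgroup.relIndex_eq_zero_of_le_right (hK.rist_le_placed_closure w)) ?_
  rw [placed, Subgroup.subgroupOf, Subgroup.relIndex_comap, placed, Subgroup.subgroupOf_map_subtype]
  refine mt (Subgroup.relIndex_eq_zero_of_le_right inf_le_left) ?_
  rw [Subgroup.relIndex_map_map_of_injective _ _ (place_injective w)]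
  exact relIndex_topologicalClosure_ne_zero hL

theorem exists_relIndex_rist_le (hK : IsNormalBranch G K) {L : Subgroup (TreeAut m)} (hLK : L ≤ K)
    (hL : L.relIndex G ≠ 0) (w : Vertex m) :
    ∃ C : ℕ, C ≠ 0 ∧ ∀ (F : FiltrationSeries G.topologicalClosure) (i : ℕ),
      (F.seq i).relIndex (rist G.topologicalClosure w) ≤
        C * (F.seq i).relIndex (placed G.topologicalClosure L w) := by
  refine ⟨_, hK.relIndex_placed_rist_ne_zero hL w, fun F i => ?_⟩
  refine (relIndex_le_relIndex_mul_relIndex_inf (hK.relIndex_placed_rist_ne_zero hL w)).trans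
    (Nat.mul_le_mul_left _ ?_)
  exact (F.relIndex_mono (inf_le_left.trans (hK.placed_closure_le hLK w)) i).trans_eq
    (F.relIndex_topologicalClosure _ i)

theorem hasFullCommutators_of_relIndex_ne_zero (hK : IsNormalBranch G K) (hm : 2 ≤ m)
    (h : (⁅K, K⁆ : Subgroup (TreeAut m)).relIndex G ≠ 0) {F : FiltrationSeries G.topologicalClosure}
    (hF : HasIndependentRists F) : HasFullCommutators K F := by
  intro w hw
  have := hK.infinite_closure hm
  obtain ⟨C, -, hC⟩ := hK.exists_relIndex_rist_le (Subgroup.commutator_le_self K) h w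
  exact F.tendsto_logIndexRatio_of_relIndex_le_mul (hK.tendsto_logIndexRatio_rist hm hF hw)
    (placed_le_rist _ _ w) (F.tendsto_const_div_log_index (Real.log C)) (hC F)

/-! #### The filtration by level stabilizers -/

theorem relIndex_placed (hK : IsNormalBranch G K) {L : Subgroup (TreeAut m)} (hLK : L ≤ K)
    (w : Vertex m) (n : ℕ) :
    ((levelStabFiltration G.topologicalClosure).seq n).relIndex (placed G.topologicalClosure L w) =
      (levelStab m n).relIndex (L.map (place w)) :=
  Subgroup.relIndex_subgroupOf
    ((hK.map_place_le w hLK).trans (hK.le.trans G.le_topologicalClosure))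

theorem exists_pow_le_mul_relIndex_rist (hK : IsNormalBranch G K) (hm : 2 ≤ m) (w : Vertex m) :
    ∃ C : ℕ, ∀ n, m ^ n ≤ C * ((levelStabFiltration G.topologicalClosure).seq n).relIndex
      (rist G.topologicalClosure w) := by
  have hpow (n : ℕ) : m ^ n ≤ K.relIndex G *
      ((levelStabFiltration G.topologicalClosure).seq (w.length + n)).relIndex
        (rist G.topologicalClosure w) :=
    calc m ^ n ≤ (levelStab m n).relIndex G :=
          pow_le_relIndex_levelStab (by omega) hK.transitive n
      _ ≤ K.relIndex G * (levelStab m n).relIndex (K ⊓ G) :=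
          relIndex_le_relIndex_mul_relIndex_inf hK.relIndex_ne_zero
      _ = K.relIndex G * ((levelStabFiltration G.topologicalClosure).seq (w.length + n)).relIndex
            (placed G.topologicalClosure K w) := by
          rw [inf_eq_left.2 hK.le, hK.relIndex_placed le_rfl, ← Subgroup.relIndex_comap,
            comap_place_levelStab]
      _ ≤ _ := Nat.mul_le_mul_left _ (FiltrationSeries.relIndex_mono _ (placed_le_rist _ _ w) _)
  refine ⟨m ^ w.length * K.relIndex G, fun n => ?_⟩
  rcases le_total w.length n with hn | hn
  · obtain ⟨j, rfl⟩ := Nat.exists_eq_add_of_le hn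
    rw [pow_add, mul_assoc]
    exact Nat.mul_le_mul_left _ (hpow j)
  · rw [mul_assoc]
    refine (Nat.pow_le_pow_right (by omega) hn).trans (Nat.le_mul_of_pos_right _ ?_)
    exact Nat.mul_pos (Nat.pos_of_ne_zero hK.relIndex_ne_zero)
      (Nat.pos_of_ne_zero (FiltrationSeries.relIndex_ne_zero _ _ _))

theorem exists_div_log_index_le (hK : IsNormalBranch G K) (hm : 2 ≤ m) (w : Vertex m) :
    ∃ c : ℝ, ∀ n : ℕ, n / Real.log ((levelStabFiltration G.topologicalClosure).seq n).index ≤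
      (c / Real.log ((levelStabFiltration G.topologicalClosure).seq n).index +
        (levelStabFiltration G.topologicalClosure).logIndexRatio
          (rist G.topologicalClosure w) n) / Real.log m := by
  set F := levelStabFiltration G.topologicalClosure
  have hlog : 0 < Real.log m := Real.log_pos (by exact_mod_cast hm)
  obtain ⟨C, hC⟩ := hK.exists_pow_le_mul_relIndex_rist hm w
  have hC₀ : (C : ℝ) ≠ 0 := by
    rintro h
    simpa [Nat.cast_eq_zero.1 h] using hC 0
  refine ⟨Real.log C, fun n => ?_⟩
  rw [FiltrationSeries.logIndexRatio, ← add_div, le_div_iff₀ hlog, div_mul_eq_mul_div,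
    ← Real.log_pow, ← Real.log_mul hC₀ (F.relIndex_pos _ n).ne']
  refine div_le_div_of_nonneg_right (Real.log_le_log ?_ ?_) (Real.log_natCast_nonneg _)
  · exact pow_pos (Nat.cast_pos.2 (by omega)) n
  · exact_mod_cast hC n

theorem tendsto_div_log_index (hK : IsNormalBranch G K) (hm : 2 ≤ m) :
    Tendsto (fun n : ℕ =>
      n / Real.log ((levelStabFiltration G.topologicalClosure).seq n).index) atTop (𝓝 0) := by
  set F := levelStabFiltration G.topologicalClosure
  have := hK.infinite_closure hm
  have hsmall : Tendsto (fun k => ((m : ℝ) ^ k)⁻¹ / Real.log m) atTop (𝓝 0) := by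
    rw [← zero_div (Real.log m)]
    exact (tendsto_inv_atTop_zero.comp
      (tendsto_pow_atTop_atTop_of_one_lt (by exact_mod_cast hm))).div_const _
  refine tendsto_order.2 ⟨fun a ha => Eventually.of_forall fun n => ha.trans_le ?_, fun a ha => ?_⟩
  · exact div_nonneg (Nat.cast_nonneg n) (Real.log_natCast_nonneg _)
  · obtain ⟨k, hka, hk⟩ := ((hsmall.eventually_lt_const ha).and (eventually_ge_atTop 1)).exists
    let w : Vertex m := List.replicate k ⟨0, by omega⟩
    have hw : w.length = k := List.length_replicate
    obtain ⟨c, hc⟩ := hK.exists_div_log_index_le hm w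
    have hlim := ((F.tendsto_const_div_log_index c).add (hK.tendsto_logIndexRatio_rist hm
      (hasIndependentRists_levelStabFiltration _) (hw.symm ▸ hk))).div_const (Real.log m)
    rw [zero_add, hw] at hlim
    filter_upwards [hlim.eventually_lt_const hka] with n hn
    exact (hc n).trans_lt hn

theorem relIndex_placed_le_mul_pow_rank (hK : IsNormalBranch G K) [Group.FG K] (w : Vertex m)
    (n : ℕ) :
    ((levelStabFiltration G.topologicalClosure).seq n).relIndex (placed G.topologicalClosure K w) ≤
      ((levelStabFiltration G.topologicalClosure).seq n).relIndex
        (placed G.topologicalClosure ⁅K, K⁆ w) * ((m !) ^ n) ^ Group.rank K := by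
  rw [hK.relIndex_placed le_rfl, hK.relIndex_placed (Subgroup.commutator_le_self K)]
  let f : K →* TreeAut m := (place w).comp K.subtype
  have hle := index_le_relIndex_commutator_mul_pow_rank ((levelStab m n).comap f)
    (e := (m !) ^ n) (by positivity) (fun k => by
      rw [Subgroup.mem_comap, map_pow]
      exact pow_factorial_pow_mem_levelStab _ n)
  rwa [← Subgroup.relIndex_top_right, Subgroup.relIndex_comap, Subgroup.relIndex_comap,
    ← Subgroup.map_map, ← Subgroup.map_map, commutator_def, Subgroup.map_commutator,
    ← MonoidHom.range_eq_map, Subgroup.range_subtype] at hle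

theorem hasFullCommutators_levelStabFiltration (hK : IsNormalBranch G K) (hm : 2 ≤ m)
    [Group.FG K] : HasFullCommutators K (levelStabFiltration G.topologicalClosure) := by
  intro w hw
  set F := levelStabFiltration G.topologicalClosure
  have := hK.infinite_closure hm
  obtain ⟨C, hC₀, hC⟩ := hK.exists_relIndex_rist_le le_rfl hK.relIndex_ne_zero w
  have hlog (n : ℕ) : Real.log ((C * ((m !) ^ n) ^ Group.rank K : ℕ) : ℝ) =
      Real.log C + n * (Group.rank K * Real.log (m ! : ℝ)) := by
    push_cast
    rw [Real.log_mul (by exact_mod_cast hC₀) (by positivity), Real.log_pow, Real.log_pow]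
    ring
  refine F.tendsto_logIndexRatio_of_relIndex_le_mul
    (C := fun n => C * ((m !) ^ n) ^ Group.rank K)
    (hK.tendsto_logIndexRatio_rist hm (hasIndependentRists_levelStabFiltration _) hw)
    (placed_le_rist _ _ w) ?_ fun n => ?_
  · have hlim := (F.tendsto_const_div_log_index (Real.log C)).add
      ((hK.tendsto_div_log_index hm).mul_const (Group.rank K * Real.log (m ! : ℝ)))
    rw [zero_mul, add_zero] at hlim
    exact hlim.congr fun n => by rw [hlog, add_div, div_mul_eq_mul_div]
  · rw [mul_assoc, mul_comm (((m !) ^ n) ^ Group.rank K)]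
    exact (hC F n).trans (Nat.mul_le_mul_left C (hK.relIndex_placed_le_mul_pow_rank w n))

end IsNormalBranch

end TreeAut

/-! ### Words below a real number -/

namespace TreeAut

variable {m : ℕ}

/-- The word `w` read as a natural number in base `m`, most significant letter first. -/
def wordVal (w : Vertex m) : ℕ := Nat.ofDigits m (w.map Fin.val).reverse

theorem wordVal_append (w u : Vertex m) :
    wordVal (w ++ u) = wordVal w * m ^ u.length + wordVal u := by
  simp only [wordVal, List.map_append, List.reverse_append, Nat.ofDigits_append,
    List.length_reverse, List.length_map, add_comm, mul_comm]

theorem lt_of_mem_reverse_map_val {w : Vertex m} {d : ℕ} (hd : d ∈ (w.map Fin.val).reverse) :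
    d < m := by
  obtain ⟨x, -, rfl⟩ := List.mem_map.1 (List.mem_reverse.1 hd)
  exact x.2

theorem wordVal_lt (hm : 2 ≤ m) (w : Vertex m) : wordVal w < m ^ w.length := by
  simpa only [wordVal, List.length_reverse, List.length_map] using
    Nat.ofDigits_lt_base_pow_length hm fun d (hd : d ∈ (w.map Fin.val).reverse) =>
      lt_of_mem_reverse_map_val hd

theorem eq_of_wordVal_eq (hm : 2 ≤ m) {u v : Vertex m} (hlen : u.length = v.length)
    (h : wordVal u = wordVal v) : u = v := by
  have hdigits := Nat.ofDigits_inj_of_len_eq hm (by simpa using hlen)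
    (fun d => lt_of_mem_reverse_map_val (w := u)) (fun d => lt_of_mem_reverse_map_val (w := v)) h
  exact List.map_injective_iff.2 Fin.val_injective (List.reverse_injective hdigits)

theorem injective_wordVal_level (hm : 2 ≤ m) (k : ℕ) :
    Function.Injective fun w : Level m k => wordVal w.1 := fun v w h =>
  Subtype.ext (eq_of_wordVal_eq hm (v.2.trans w.2.symm) h)

/-- The `m`-adic interval `[wordVal w / m ^ |w|, (wordVal w + 1) / m ^ |w|]` of the infinite words
that begin with `w` lies in `[0, α]`. -/
def Below (α : ℝ) (w : Vertex m) : Prop := (wordVal w + 1 : ℝ) ≤ α * (m : ℝ) ^ w.length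

theorem Below.append (hm : 2 ≤ m) {α : ℝ} {w : Vertex m} (h : Below α w) (u : Vertex m) :
    Below α (w ++ u) := by
  have hu : (wordVal u + 1 : ℝ) ≤ (m : ℝ) ^ u.length := by exact_mod_cast wordVal_lt hm u
  calc (wordVal (w ++ u) + 1 : ℝ) = wordVal w * (m : ℝ) ^ u.length + (wordVal u + 1) := by
        rw [wordVal_append]
        push_cast
        ring
    _ ≤ (wordVal w + 1) * (m : ℝ) ^ u.length := by linarith
    _ ≤ α * (m : ℝ) ^ w.length * (m : ℝ) ^ u.length := mul_le_mul_of_nonneg_right h (by positivity)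
    _ = α * (m : ℝ) ^ (w ++ u).length := by rw [List.length_append, pow_add, mul_assoc]

theorem not_below_append {α : ℝ} {w : Vertex m} (h : α * (m : ℝ) ^ w.length ≤ wordVal w)
    (u : Vertex m) : ¬ Below α (w ++ u) := by
  refine not_le.2 ?_
  calc α * (m : ℝ) ^ (w ++ u).length = α * (m : ℝ) ^ w.length * (m : ℝ) ^ u.length := by
        rw [List.length_append, pow_add, mul_assoc]
    _ ≤ wordVal w * (m : ℝ) ^ u.length := mul_le_mul_of_nonneg_right h (by positivity)
    _ ≤ wordVal (w ++ u) := by exact_mod_cast (wordVal_append w u).symm ▸ Nat.le_add_right _ _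
    _ < wordVal (w ++ u) + 1 := lt_add_one _

/-- The shortest words whose `m`-adic intervals lie in `[0, α]`. For `0 ≤ α ≤ 1` these
intervals, without their right endpoints, tile `[0, α)`. -/
def minimalBelow (m : ℕ) (α : ℝ) : Set (Vertex m) :=
  {v | Below α v ∧ ∀ p, p <+: v → Below α p → p = v}

theorem prefixFree_minimalBelow (α : ℝ) : PrefixFree (minimalBelow m α) :=
  fun _ hv _ hw h => hw.2 _ h hv.1

theorem Below.exists_prefix {α : ℝ} {w : Vertex m} (h : Below α w) :
    ∃ v ∈ minimalBelow m α, v <+: w := by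
  obtain ⟨v, ⟨hvw, hv⟩, hmin⟩ := exists_minimalFor_of_wellFoundedLT
    (fun p => p <+: w ∧ Below α p) List.length ⟨w, List.prefix_rfl, h⟩
  exact ⟨v, ⟨hv, fun p hpv hp => hpv.eq_of_length_le
    (hmin ⟨hpv.trans hvw, hp⟩ hpv.length_le)⟩, hvw⟩

theorem exists_finset_level_of_lt (hm : 2 ≤ m) {α : ℝ} (hα : 0 ≤ α) (k : ℕ) :
    ∃ A : Finset (Level m k), (A.card : ℝ) ≤ α * (m : ℝ) ^ k + 1 ∧
      ∀ w ∉ A, α * (m : ℝ) ^ k ≤ wordVal w.1 := by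
  classical
  let A : Finset (Level m k) := {w | (wordVal w.1 : ℝ) < α * (m : ℝ) ^ k}
  refine ⟨A, ?_, fun w hw => not_lt.1 fun hlt => hw (Finset.mem_filter.2 ⟨Finset.mem_univ _, hlt⟩)⟩
  have hcard : A.card ≤ (Finset.range ⌈α * (m : ℝ) ^ k⌉₊).card :=
    Finset.card_le_card_of_injOn (fun w => wordVal w.1)
      (fun w hw => Finset.mem_coe.2 (Finset.mem_range.2 (Nat.lt_ceil.2 (Finset.mem_filter.1 hw).2)))
      (injective_wordVal_level hm k).injOn
  rw [Finset.card_range] at hcard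
  exact (Nat.cast_le.2 hcard).trans (Nat.ceil_lt_add_one (by positivity)).le

theorem exists_finset_level_below (hm : 2 ≤ m) {α : ℝ} (hα : α ∈ Set.Icc (0 : ℝ) 1) (k : ℕ) :
    ∃ A : Finset (Level m k), α * (m : ℝ) ^ k - 1 ≤ A.card ∧ ∀ w ∈ A, Below α w.1 := by
  classical
  refine ⟨({w | Below α w.1} : Finset (Level m k)), ?_, fun w hw => (Finset.mem_filter.1 hw).2⟩
  have hnot : ({w | ¬ Below α w.1} : Finset (Level m k)).card ≤
      (Finset.Ico ⌊α * (m : ℝ) ^ k⌋₊ (m ^ k)).card := by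
    refine Finset.card_le_card_of_injOn (fun w => wordVal w.1) (fun w hw => ?_)
      (injective_wordVal_level hm k).injOn
    have hlt : α * (m : ℝ) ^ k < wordVal w.1 + 1 := by
      simpa only [Below, w.2, not_le] using (Finset.mem_filter.1 hw).2
    refine Finset.mem_coe.2 (Finset.mem_Ico.2 ⟨Nat.lt_succ_iff.1 ?_, ?_⟩)
    · exact (Nat.floor_lt (mul_nonneg hα.1 (by positivity))).2 (by exact_mod_cast hlt)
    · simpa only [w.2] using wordVal_lt hm w.1
  have hfloor : ⌊α * (m : ℝ) ^ k⌋₊ ≤ m ^ k := by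
    refine Nat.floor_le_of_le ?_
    rw [Nat.cast_pow]
    exact mul_le_of_le_one_left (by positivity) hα.2
  have hcard := Finset.card_filter_add_card_filter_not (s := (Finset.univ : Finset (Level m k)))
    fun w => Below α w.1
  rw [Finset.card_univ, card_level] at hcard
  rw [Nat.card_Ico] at hnot
  have hle : ⌊α * (m : ℝ) ^ k⌋₊ ≤ ({w | Below α w.1} : Finset (Level m k)).card := by omega
  exact (Nat.sub_one_lt_floor _).le.trans (Nat.cast_le.2 hle)

theorem exists_finset_level_minimalBelow_prefix (hm : 2 ≤ m) {α : ℝ} (hα : α ∈ Set.Icc (0 : ℝ) 1)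
    (j : ℕ) :
    ∃ B : Finset (Level m (j + j)), (α * (m : ℝ) ^ j - 1) * (m : ℝ) ^ j ≤ B.card ∧
      ∀ w ∈ B, ∃ v ∈ minimalBelow m α, v <+: w.1 ∧ v.length ≤ j := by
  classical
  obtain ⟨A, hcard, hA⟩ := exists_finset_level_below hm hα j
  let concat (p : Level m j × Level m j) : Level m (j + j) :=
    ⟨p.1.1 ++ p.2.1, by rw [List.length_append, p.1.2, p.2.2]⟩
  have hconcat : Function.Injective concat := fun p q h =>
    have hpq := List.append_inj (congrArg Subtype.val h) (p.1.2.trans q.1.2.symm)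
    Prod.ext (Subtype.ext hpq.1) (Subtype.ext hpq.2)
  refine ⟨(A ×ˢ Finset.univ).image concat, ?_, fun w hw => ?_⟩
  · rw [Finset.card_image_of_injective _ hconcat, Finset.card_product, Finset.card_univ, card_level]
    push_cast
    exact mul_le_mul_of_nonneg_right hcard (by positivity)
  · obtain ⟨⟨a, c⟩, hac, rfl⟩ := Finset.mem_image.1 hw
    obtain ⟨v, hv, hva⟩ := (hA a (Finset.mem_product.1 hac).1).exists_prefix
    exact ⟨v, hv, hva.trans (List.prefix_append _ _), hva.length_le.trans_eq a.2⟩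

end TreeAut

/-! ### Subgroups of prescribed density -/

theorem exists_finset_closure_eq_iSup_range {K A ι : Type*} [Group K] [Group A] [Group.FG K]
    [Fintype ι] (φ : ι → K →* A) :
    ∃ S : Finset A, S.card ≤ Fintype.card ι * Group.rank K ∧
      Subgroup.closure (S : Set A) = ⨆ i, (φ i).range := by
  classical
  obtain ⟨S, hcard, hS⟩ := Group.rank_spec K
  refine ⟨Finset.univ.biUnion fun i => S.image (φ i), ?_, ?_⟩
  · exact Finset.card_biUnion_le_card_mul _ _ _ fun i _ => Finset.card_image_le.trans_eq hcard
  · simp only [Finset.coe_biUnion, Finset.coe_univ, Set.mem_univ, Set.iUnion_true,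
      Subgroup.closure_iUnion, Finset.coe_image, ← MonoidHom.map_closure, hS,
      MonoidHom.range_eq_map]

theorem map_commutator_self_le {A : Type*} [Group A] {K : Subgroup A} {f : A →* A}
    (h : K.map f ≤ K) : (⁅K, K⁆ : Subgroup A).map f ≤ ⁅K, K⁆ :=
  (Subgroup.map_commutator K K f).trans_le (Subgroup.commutator_mono h h)

namespace TreeAut

open scoped commutatorElement

variable {m : ℕ}

theorem conj_graft_place {V : Set (Vertex m)} (hV : PrefixFree V) {v : Vertex m} (hv : v ∈ V)
    (s : Vertex m → TreeAut m) (g : TreeAut m) :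
    graft hV s * place v g * (graft hV s)⁻¹ = place v (s v * g * (s v)⁻¹) := by
  classical
  simp only [← graft_mulSingle hV hv, ← map_mul, ← map_inv]
  refine graft_congr hV fun w _ => ?_
  by_cases hwv : w = v
  · subst hwv
    simp only [Pi.mul_apply, Pi.inv_apply, Pi.mulSingle_eq_same]
  · simp only [Pi.mul_apply, Pi.inv_apply, Pi.mulSingle_eq_of_ne hwv, mul_one, mul_inv_cancel]

/-- For distinct `v, v'` in `V` the vertices `g v, g v'` are incomparable, so that in the component
`v'` elements placed at these vertices commute. -/
theorem commutator_graft_place_graft {V : Set (Vertex m)} (hV : PrefixFree V) {v : Vertex m}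
    (hv : v ∈ V) (g x y : TreeAut m) :
    ⁅graft hV (fun v' => place (g.1 v') x), graft hV (fun _ => place (g.1 v) y)⁆ =
      place v (place (g.1 v) ⁅x, y⁆) := by
  classical
  rw [← map_commutatorElement, ← graft_mulSingle hV hv]
  refine graft_congr hV fun v' hv' => ?_
  change ⁅place (g.1 v') x, place (g.1 v) y⁆ = _
  by_cases hvv : v' = v
  · subst hvv
    rw [Pi.mulSingle_eq_same, map_commutatorElement]
  · rw [Pi.mulSingle_eq_of_ne hvv, commutatorElement_eq_one_iff_commute]
    refine (supportedAt_place _ x).commute (supportedAt_place _ y) ?_ ?_ <;> rw [apply_prefix_iff]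
    · exact fun h => hvv (hV hv' hv h)
    · exact fun h => hvv (hV hv hv' h).symm

theorem isClosed_coneFixer (Γ : Subgroup (TreeAut m)) (w : Vertex m) :
    IsClosed (coneFixer Γ w : Set Γ) := by
  have hinter : (coneFixer Γ w : Set Γ) =
      ⋂ u, Subtype.val ⁻¹' {g : TreeAut m | g.1 (w ++ u) = w ++ u} := by
    ext g
    rw [Set.mem_iInter]
    exact Iff.rfl
  rw [hinter]
  exact isClosed_iInter fun u => (isClosed_fixing _).preimage continuous_subtype_val

namespace IsNormalBranch

variable {G K : Subgroup (TreeAut m)}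

theorem conj_mem_commutator (hK : IsNormalBranch G K) {g c : TreeAut m} (hg : g ∈ G)
    (hc : c ∈ (⁅K, K⁆ : Subgroup (TreeAut m))) : g * c * g⁻¹ ∈ (⁅K, K⁆ : Subgroup (TreeAut m)) := by
  refine map_commutator_self_le (f := (MulAut.conj g).toMonoidHom) ?_ ⟨c, hc, rfl⟩
  rintro _ ⟨k, hk, rfl⟩
  exact hK.conj_mem g hg k hk

theorem place_mem_commutator (hK : IsNormalBranch G K) (w : Vertex m) {c : TreeAut m}
    (hc : c ∈ (⁅K, K⁆ : Subgroup (TreeAut m))) : place w c ∈ (⁅K, K⁆ : Subgroup (TreeAut m)) :=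
  map_commutator_self_le (hK.map_place_le w le_rfl) ⟨c, hc, rfl⟩

section PlaceCommutator

variable {V : Set (Vertex m)} {H : Subgroup (TreeAut m)} {v : Vertex m} {c : TreeAut m}

theorem place_place_commutator_mem_of_shift (hK : IsNormalBranch G K) (hV : PrefixFree V)
    (hdiag : ∀ k ∈ K, graft hV (fun _ => k) ∈ H) {g : TreeAut m}
    (hshift : ∀ k ∈ K, graft hV (fun v => place (g.1 v) k) ∈ H) (hv : v ∈ V)
    (hc : c ∈ (⁅K, K⁆ : Subgroup (TreeAut m))) : place v (place (g.1 v) c) ∈ H := by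
  have hle : (⁅K, K⁆ : Subgroup (TreeAut m)) ≤ H.comap ((place v).comp (place (g.1 v))) := by
    refine Subgroup.commutator_le.2 fun x hx y hy => ?_
    change place v (place (g.1 v) ⁅x, y⁆) ∈ H
    rw [← commutator_graft_place_graft hV hv]
    have hy' := hdiag _ (hK.place_mem (g.1 v) y hy)
    exact mul_mem (mul_mem (mul_mem (hshift x hx) hy') (inv_mem (hshift x hx))) (inv_mem hy')
  exact hle hc

theorem place_place_commutator_mem (hK : IsNormalBranch G K) (hV : PrefixFree V)
    {T : Set (TreeAut m)} (hTG : T ⊆ G) (hT : ∀ g ∈ G, ∃ t ∈ T, t⁻¹ * g ∈ K)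
    (hdiag : ∀ k ∈ K, graft hV (fun _ => k) ∈ H)
    (hshift : ∀ t ∈ T, ∀ k ∈ K, graft hV (fun v => place (t.1 v) k) ∈ H) (hv : v ∈ V)
    {u : Vertex m} (hu : u.length = v.length) (hc : c ∈ (⁅K, K⁆ : Subgroup (TreeAut m))) :
    place v (place u c) ∈ H := by
  obtain ⟨g, hg, rfl⟩ := hK.transitive v u hu.symm
  obtain ⟨t, ht, htg⟩ := hT g hg
  obtain ⟨k, hk, rfl⟩ : ∃ k ∈ K, k * t = g :=
    ⟨g * t⁻¹, by simpa [mul_assoc] using hK.conj_mem t (hTG ht) _ htg, inv_mul_cancel_right g t⟩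
  set s := sec k (t.1 v)
  have hsc : s⁻¹ * c * s ∈ (⁅K, K⁆ : Subgroup (TreeAut m)) := by
    simpa only [inv_inv] using
      hK.conj_mem_commutator (inv_mem (hK.sec_mem k (hK.le hk) (t.1 v))) hc
  have hconj : k * place (t.1 v) (s⁻¹ * c * s) * k⁻¹ = place ((k * t).1 v) c := by
    rw [conj_place, mul_apply]
    exact congrArg _ (by simp only [s]; group)
  rw [← hconj, ← conj_graft_place hV hv fun _ => k]
  exact mul_mem (mul_mem (hdiag k hk)
    (hK.place_place_commutator_mem_of_shift hV hdiag (hshift t ht) hv hsc)) (inv_mem (hdiag k hk))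

theorem place_commutator_mem (hK : IsNormalBranch G K) (hV : PrefixFree V)
    {T : Set (TreeAut m)} (hTG : T ⊆ G) (hT : ∀ g ∈ G, ∃ t ∈ T, t⁻¹ * g ∈ K)
    (hdiag : ∀ k ∈ K, graft hV (fun _ => k) ∈ H)
    (hshift : ∀ t ∈ T, ∀ k ∈ K, graft hV (fun v => place (t.1 v) k) ∈ H) (hv : v ∈ V)
    {w : Vertex m} (hvw : v <+: w) (hlen : v.length + v.length ≤ w.length)
    (hc : c ∈ (⁅K, K⁆ : Subgroup (TreeAut m))) : place w c ∈ H := by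
  obtain ⟨u, rfl⟩ := hvw
  rw [List.length_append, Nat.add_le_add_iff_left] at hlen
  rw [← List.take_append_drop v.length u, place_append, place_append]
  exact hK.place_place_commutator_mem hV hTG hT hdiag hshift hv (List.length_take_of_le hlen)
    (hK.place_mem_commutator _ hc)

end PlaceCommutator

/-- The homomorphism that maps `k` to the element acting as `φ v k` below each vertex `v ∈ V`. -/
noncomputable def graftHom (hK : IsNormalBranch G K) {V : Set (Vertex m)} (hV : PrefixFree V)
    (φ : Vertex m → TreeAut m →* TreeAut m) (hφ : ∀ v, K.map (φ v) ≤ K) :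
    K →* G.topologicalClosure :=
  ((graft hV).comp (MonoidHom.pi fun v => (φ v).comp K.subtype)).codRestrict G.topologicalClosure
    fun k => hK.closure_le (hK.graft_mem_closure hV fun v _ => hφ v ⟨k, k.2, rfl⟩)

/-- The diagonal copy of `K` below the vertices of `V` (index `none`), and its copies shifted by the
elements `t` of `T`. -/
noncomputable def diagonalHom (hK : IsNormalBranch G K) {V : Set (Vertex m)} (hV : PrefixFree V)
    (T : Finset (TreeAut m)) : Option T → K →* G.topologicalClosure
  | none => hK.graftHom hV (fun _ => MonoidHom.id _) fun _ => K.map_id.le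
  | some t => hK.graftHom hV (fun v => place (t.1.1 v)) fun v => hK.map_place_le (t.1.1 v) le_rfl

theorem iSup_range_diagonalHom_le_coneFixer (hK : IsNormalBranch G K) {V : Set (Vertex m)}
    (hV : PrefixFree V) (T : Finset (TreeAut m)) {w : Vertex m}
    (hw : ∀ u, ¬ ∃ v ∈ V, v <+: w ++ u) :
    ⨆ o, (hK.diagonalHom hV T o).range ≤ coneFixer G.topologicalClosure w :=
  iSup_le fun o => by
    rintro _ ⟨k, rfl⟩ u
    cases o <;> exact graft_apply_of_not hV _ (hw u)

theorem placed_commutator_le_iSup_range_diagonalHom (hK : IsNormalBranch G K)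
    {V : Set (Vertex m)} (hV : PrefixFree V) {T : Finset (TreeAut m)} (hTG : ∀ t ∈ T, t ∈ G)
    (hT : ∀ g ∈ G, ∃ t ∈ T, t⁻¹ * g ∈ K) {v w : Vertex m} (hv : v ∈ V) (hvw : v <+: w)
    (hlen : v.length + v.length ≤ w.length) :
    placed G.topologicalClosure ⁅K, K⁆ w ≤ ⨆ o, (hK.diagonalHom hV T o).range := by
  rintro g ⟨c, hc, hcg⟩
  have hmem (o) (k : K) : (hK.diagonalHom hV T o k).1 ∈
      (⨆ o, (hK.diagonalHom hV T o).range).map G.topologicalClosure.subtype :=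
    ⟨_, le_iSup (fun o => (hK.diagonalHom hV T o).range) o ⟨k, rfl⟩, rfl⟩
  have hplace := hK.place_commutator_mem hV (T := T) hTG hT (fun k hk => hmem none ⟨k, hk⟩)
    (fun t ht k hk => hmem (some ⟨t, ht⟩) ⟨k, hk⟩) hv hvw hlen hc
  rw [show place w c = g.1 from hcg] at hplace
  exact (Subgroup.mem_map_iff_mem Subtype.val_injective).1 hplace

end IsNormalBranch

/-- The combinatorial data from which the Hausdorff dimension of `H` can be read off: `H` acts
trivially below all but about `α * m ^ k` vertices of each level `k`, and contains copies of the
commutator subgroup of `K` at about `α * m ^ k` vertices of each even level `k`. -/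
structure HasDensity {Γ : Subgroup (TreeAut m)} (K : Subgroup (TreeAut m)) (H : Subgroup Γ)
    (α : ℝ) : Prop where
  exists_le_coneFixer : ∀ k : ℕ, ∃ A : Finset (Level m k), (A.card : ℝ) ≤ α * (m : ℝ) ^ k + 1 ∧
    ∀ w ∉ A, H ≤ coneFixer Γ w.1
  exists_placed_commutator_le : ∀ j : ℕ, ∃ B : Finset (Level m (j + j)),
    (α * (m : ℝ) ^ j - 1) * (m : ℝ) ^ j ≤ B.card ∧ ∀ w ∈ B, placed Γ ⁅K, K⁆ w.1 ≤ H

theorem IsNormalBranch.exists_hasDensity {G K : Subgroup (TreeAut m)} (hK : IsNormalBranch G K)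
    (hm : 2 ≤ m) [Group.FG K] :
    ∃ b : ℕ, ∀ α ∈ Set.Icc (0 : ℝ) 1, ∃ S : Finset G.topologicalClosure, S.card ≤ b ∧
      HasDensity K (Subgroup.closure (S : Set G.topologicalClosure)).topologicalClosure α := by
  obtain ⟨T, hTG, hT⟩ := exists_finset_cover_of_relIndex_ne_zero hK.relIndex_ne_zero
  refine ⟨Fintype.card (Option T) * Group.rank K, fun α hα => ?_⟩
  have hV := prefixFree_minimalBelow (m := m) α
  obtain ⟨S, hcard, hS⟩ := exists_finset_closure_eq_iSup_range (hK.diagonalHom hV T)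
  refine ⟨S, hcard, ?_⟩
  rw [hS]
  refine ⟨fun k => ?_, fun j => ?_⟩
  · obtain ⟨A, hA, hval⟩ := exists_finset_level_of_lt hm hα.1 k
    refine ⟨A, hA, fun w hw => Subgroup.topologicalClosure_minimal _
      (hK.iSup_range_diagonalHom_le_coneFixer hV T ?_) (isClosed_coneFixer _ w.1)⟩
    rintro u ⟨v, hv, hvu⟩
    have hbelow : Below α (w.1 ++ u) := by
      obtain ⟨z, hz⟩ := hvu
      exact hz ▸ hv.1.append hm z
    refine not_below_append ?_ u hbelow
    rw [w.2]
    exact hval w hw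
  · obtain ⟨B, hB, hprefix⟩ := exists_finset_level_minimalBelow_prefix hm hα j
    refine ⟨B, hB, fun w hw => ?_⟩
    obtain ⟨v, hv, hvw, hvj⟩ := hprefix w hw
    exact (hK.placed_commutator_le_iSup_range_diagonalHom hV hTG hT hv hvw
      ((add_le_add hvj hvj).trans_eq w.2.symm)).trans (Subgroup.le_topologicalClosure _)

end TreeAut

/-! ### Hausdorff dimensions -/

namespace TreeAut

open Filter

variable {m : ℕ} {G K : Subgroup (TreeAut m)}

theorem HasDensity.eventually_logIndexRatio_lt (hK : IsNormalBranch G K) (hm : 2 ≤ m)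
    {F : FiltrationSeries G.topologicalClosure} (hF : HasIndependentRists F)
    {H : Subgroup G.topologicalClosure} {α a : ℝ} (hH : HasDensity K H α) (ha : α < a) :
    ∀ᶠ i in atTop, F.logIndexRatio H i < a := by
  have := hK.infinite_closure hm
  have hpow : Tendsto (fun k => (m : ℝ) ^ k) atTop atTop :=
    tendsto_pow_atTop_atTop_of_one_lt (by exact_mod_cast hm)
  obtain ⟨k, hk, hk₁⟩ :=
    ((hpow.eventually_gt_atTop (a - α)⁻¹).and (eventually_ge_atTop 1)).exists
  obtain ⟨w, rfl⟩ : ∃ w : Vertex m, w.length = k :=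
    ⟨List.replicate k ⟨0, by omega⟩, List.length_replicate⟩
  have hmpos : (0 : ℝ) < (m : ℝ) ^ w.length := pow_pos (Nat.cast_pos.2 (by omega)) _
  obtain ⟨A, hcard, hfix⟩ := hH.exists_le_coneFixer w.length
  obtain ⟨C, hC⟩ := hK.exists_relIndex_le_mul_prod_rist w.length
  have hle (i : ℕ) : F.logIndexRatio H i ≤ Real.log C / Real.log (F.seq i).index +
      A.card * F.logIndexRatio (rist G.topologicalClosure w) i := by
    rw [← sum_logIndexRatio_rist F hK.transitive_closure]
    exact F.logIndexRatio_le_add_sum (hC F A H hfix i)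
  have hlim := (F.tendsto_const_div_log_index (Real.log C)).add
    ((hK.tendsto_logIndexRatio_rist hm hF hk₁).const_mul (A.card : ℝ))
  have hlt : 0 + A.card * ((m : ℝ) ^ w.length)⁻¹ < a := by
    rw [zero_add, ← div_eq_mul_inv, div_lt_iff₀ hmpos]
    have := (inv_lt_iff_one_lt_mul₀ (sub_pos.2 ha)).1 hk
    linarith
  filter_upwards [hlim.eventually_lt_const hlt] with i hi
  exact (hle i).trans_lt hi

theorem HasDensity.eventually_lt_logIndexRatio (hm : 2 ≤ m)
    {F : FiltrationSeries G.topologicalClosure} (hF : HasIndependentRists F)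
    (hfull : HasFullCommutators K F) {H : Subgroup G.topologicalClosure} {α a : ℝ}
    (hH : HasDensity K H α) (ha : a < α) : ∀ᶠ i in atTop, a < F.logIndexRatio H i := by
  have hpow : Tendsto (fun j => (m : ℝ) ^ j) atTop atTop :=
    tendsto_pow_atTop_atTop_of_one_lt (by exact_mod_cast hm)
  obtain ⟨j, hj, hj₁⟩ :=
    ((hpow.eventually_gt_atTop (α - a)⁻¹).and (eventually_ge_atTop 1)).exists
  have hmpos : (0 : ℝ) < (m : ℝ) ^ j := pow_pos (Nat.cast_pos.2 (by omega)) _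
  obtain ⟨B, hcard, hBH⟩ := hH.exists_placed_commutator_le j
  have hlim : Tendsto
      (fun i => ∑ w ∈ B, F.logIndexRatio (placed G.topologicalClosure ⁅K, K⁆ w.1) i) atTop
      (𝓝 (B.card * ((m : ℝ) ^ (j + j))⁻¹)) := by
    rw [← nsmul_eq_mul, ← Finset.sum_const]
    refine tendsto_finsetSum B fun w _ => ?_
    simpa only [w.2] using hfull w.1 (by rw [w.2]; omega)
  have hlt : a < B.card * ((m : ℝ) ^ (j + j))⁻¹ := by
    rw [← div_eq_mul_inv, lt_div_iff₀ (by positivity), pow_add, ← mul_assoc]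
    refine (mul_lt_mul_of_pos_right ?_ hmpos).trans_le hcard
    have := (inv_lt_iff_one_lt_mul₀ (sub_pos.2 ha)).1 hj
    linarith
  filter_upwards [hlim.eventually_const_lt hlt, hF (j + j) (by omega)] with i hi hind
  refine hi.trans_le (F.sum_logIndexRatio_le ?_)
  rw [← relIndex_iSup_eq_prod_of_le_rist hind B fun w _ => placed_le_rist _ _ w.1]
  exact F.relIndex_mono (iSup_le fun w : B => hBH w.1 w.2) i

theorem HasDensity.tendsto_logIndexRatio (hK : IsNormalBranch G K) (hm : 2 ≤ m)
    {F : FiltrationSeries G.topologicalClosure} (hF : HasIndependentRists F)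
    (hfull : HasFullCommutators K F) {H : Subgroup G.topologicalClosure} {α : ℝ}
    (hH : HasDensity K H α) : Tendsto (F.logIndexRatio H) atTop (𝓝 α) :=
  tendsto_order.2 ⟨fun _ => hH.eventually_lt_logIndexRatio hm hF hfull,
    fun _ => hH.eventually_logIndexRatio_lt hK hm hF⟩

namespace IsNormalBranch

theorem exists_Icc_subset_hspecBounded (hK : IsNormalBranch G K) (hm : 2 ≤ m) [Group.FG K] :
    ∃ b : ℕ, ∀ F : FiltrationSeries G.topologicalClosure, HasIndependentRists F →
      HasFullCommutators K F → Set.Icc 0 1 ⊆ F.hspecBounded b := by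
  have := hK.infinite_closure hm
  obtain ⟨b, hb⟩ := hK.exists_hasDensity hm
  refine ⟨b, fun F hF hfull d hd => ?_⟩
  have hd_top : d ≠ ⊤ := ne_top_of_le_ne_top ENNReal.one_ne_top hd.2
  obtain ⟨S, hS, hdensity⟩ :=
    hb d.toReal ⟨ENNReal.toReal_nonneg, ENNReal.toReal_mono ENNReal.one_ne_top hd.2⟩
  have hclosed := (Subgroup.closure (S : Set G.topologicalClosure)).isClosed_topologicalClosure
  refine ⟨_, hclosed, ⟨S, hS, rfl⟩, ?_⟩
  rw [F.hdim_eq_of_tendsto hclosed (hdensity.tendsto_logIndexRatio hK hm hF hfull),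
    ENNReal.ofReal_toReal hd_top]

open scoped commutatorElement in
theorem commutator_ne_bot (hK : IsNormalBranch G K) (hne : K ≠ ⊥) :
    (⁅K, K⁆ : Subgroup (TreeAut m)) ≠ ⊥ := by
  intro hbot
  obtain ⟨⟨k, hk⟩, hk₁⟩ := Subgroup.ne_bot_iff_exists_ne_one.1 hne
  have hk_ne : k ≠ 1 := fun h => hk₁ (Subtype.ext h)
  obtain ⟨u, hu⟩ : ∃ u, k.1 u ≠ u := by
    by_contra! h
    exact hk_ne (ext_apply h)
  have hcomm : Commute k (place u k) := by
    rw [← commutatorElement_eq_one_iff_commute, ← Subgroup.mem_bot, ← hbot]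
    exact Subgroup.commutator_mem_commutator hk (hK.place_mem u k hk)
  have hconj : SupportedAt (k.1 u) (place u k) := by
    simpa only [hcomm.eq, mul_inv_cancel_right] using (supportedAt_place u k).conj k
  have hincomp : ¬ k.1 u <+: u ++ u := fun h => hu <|
    (List.prefix_of_prefix_length_le h (u.prefix_append u) (length_apply k u).le).eq_of_length
      (length_apply k u)
  have hfix := hconj.2 _ hincomp
  rw [place_apply_append] at hfix
  exact hu (List.append_cancel_left hfix)

theorem relIndex_commutator_ne_zero (hK : IsNormalBranch G K) (hG : IsJustInfinite G) :
    (⁅K, K⁆ : Subgroup (TreeAut m)).relIndex G ≠ 0 := by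
  have hle : (⁅K, K⁆ : Subgroup (TreeAut m)) ≤ G := (Subgroup.commutator_le_self K).trans hK.le
  have hne : K ≠ ⊥ := by
    rintro rfl
    have := hG.1
    exact hK.relIndex_ne_zero (by rw [Subgroup.relIndex_bot_left, Nat.card_eq_zero_of_infinite])
  have hnormal : ((⁅K, K⁆ : Subgroup (TreeAut m)).subgroupOf G).Normal :=
    ⟨fun c hc g => hK.conj_mem_commutator g.2 hc⟩
  refine (hG.2 _ hnormal fun h => hK.commutator_ne_bot hne ?_).index_ne_zero
  exact (Subgroup.subgroupOf_eq_bot.1 h).eq_bot_of_le hle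

theorem fg (hK : IsNormalBranch G K) (hfg : Group.FG G) : Group.FG K := by
  have : (K.subgroupOf G).FiniteIndex := ⟨hK.relIndex_ne_zero⟩
  have e := Subgroup.subgroupOfEquivOfLe hK.le
  exact Group.fg_of_surjective (f := e.toMonoidHom) e.surjective

end IsNormalBranch

end TreeAut

theorem mainTheorem1 (m : ℕ) (hm : 2 ≤ m) (G : Subgroup (TreeAut m)) (hfg : Group.FG G)
    (hG : TreeAut.IsRegularBranch G) :
    ∃ b : ℕ, 2 ≤ b ∧
      ((TreeAut.levelStabFiltration G.topologicalClosure).hspecBounded b = Set.Icc 0 1 ∧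
        (TreeAut.levelStabFiltration G.topologicalClosure).hspecFG = Set.Icc 0 1 ∧
        (TreeAut.levelStabFiltration G.topologicalClosure).hspec = Set.Icc 0 1) ∧
      (IsJustInfinite G → ∀ N : FiltrationSeries G.topologicalClosure,
        TreeAut.IsNice G.topologicalClosure N →
          N.hspecBounded b = Set.Icc 0 1 ∧ N.hspecFG = Set.Icc 0 1 ∧
            N.hspec = Set.Icc 0 1) := by
  obtain ⟨K, hK⟩ := hG.exists_isNormalBranch
  have : Group.FG K := hK.fg hfg
  have : Infinite G.topologicalClosure := hK.infinite_closure hm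
  obtain ⟨b, hb⟩ := hK.exists_Icc_subset_hspecBounded hm
  have hspec_eq (F : FiltrationSeries G.topologicalClosure) (hF : TreeAut.HasIndependentRists F)
      (hfull : TreeAut.HasFullCommutators K F) :=
    F.hspec_eq_Icc_of_subset ((hb F hF hfull).trans (F.hspecBounded_mono (Nat.le_add_right b 2)))
  refine ⟨b + 2, Nat.le_add_left 2 b, ?_, fun hJI N hN => ?_⟩
  · exact hspec_eq _ (TreeAut.hasIndependentRists_levelStabFiltration _)
      (hK.hasFullCommutators_levelStabFiltration hm)
  · exact hspec_eq N hN.hasIndependentRists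
      (hK.hasFullCommutators_of_relIndex_ne_zero hm (hK.relIndex_commutator_ne_zero hJI)
        hN.hasIndependentRists)
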